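/- A \emph{Chinese character} is a finite graph (loops, multiple edges and disconnected graphs allowed) all of whose vertices have valency $1$ (the \emph{legs}) or $3$, together with a cyclic order of the edge-ends at each trivalent vertex. Its degree is half its number of vertices. Let $\mathcal B$ be the $\mathbb Q$-vector space spanned by the isomorphism classes of Chinese characters, modulo the antisymmetry relation (reversing the cyclic order at one vertex changes the sign) and the IHX relation; let $\mathcal A(\emptyset)$ be the space defined in the same way from the Chinese characters without legs (trivalent graphs), and let $\mathcal A(\emptyset)_n$ be its degree $n$ part, spanned by the graphs with $2n$ vertices. For $k\ge 1$ the wheel with $k$ legs is the cycle of $k$ trivalent vertices with one leg attached to each of them. Let $\mathcal B_{wh}\subset\mathcal B$ be the subspace spanned by the Chinese characters every component of which is a wheel (including the empty one), and let $(\mathcal B_{wh})_m$ be its degree $m$ part. The closure $\langle C\rangle$ of a Chinese character $C$ is the sum of the trivalent graphs obtained from $C$ by joining its legs in pairs in all possible ways ($(2m-1)!!$ ways if there are $2m$ legs; the sum is $0$ if the number of legs is odd). If $C$ has interval components (edges joining two legs), circles without vertices can arise; they are replaced by a fixed number $z\in\mathbb Q$. No circle arises for $C$ without interval components, so the choice of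 $z$ does not matter on $\mathcal B_{wh}$. The closure induces a linear map $\mathcal B\to\mathcal A(\emptyset)$, $x\mapsto\langle x\rangle$. \textbf{Lemma.} The restriction $\mathcal B_{wh}\to\mathcal A(\emptyset)$, $x\mapsto\langle x\rangle$, is injective. For every $n\ge 0$ it maps $(\mathcal B_{wh})_{2n}$ into $\mathcal A(\emptyset)_n$, and for every $n\ge 4$ the resulting map $(\mathcal B_{wh})_{2n}\to\mathcal A(\emptyset)_n$ is not surjective. -/

import Mathlib

open scoped DirectSum

namespace JacobiDiagram

/-! ### Pairings and joining of paths -/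

/-- A perfect matching of `X`, encoded as a fixed-point-free involution. -/
def IsMatching {X : Type} (τ : Equiv.Perm X) : Prop :=
  (∀ x, τ (τ x) = x) ∧ ∀ x, τ x ≠ x

instance {X : Type} [Fintype X] [DecidableEq X] (τ : Equiv.Perm X) : Decidable (IsMatching τ) :=
  inferInstanceAs (Decidable (_ ∧ _))

section Glue

variable {W U W' U' : Type}

/-- One step of the walk along a graph with edges `σ` whose legs `U` are joined by `τ`:
cross the join if at a leg, then cross an edge. -/
def walk (σ : Equiv.Perm (W ⊕ U)) (τ : Equiv.Perm U) : Equiv.Perm (W ⊕ U) :=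
  σ * Equiv.sumCongr 1 τ

theorem exists_return [Finite W] [Finite U] (σ : Equiv.Perm (W ⊕ U)) (τ : Equiv.Perm U) (a : W) :
    ∃ k, 0 < k ∧ ∃ b, (walk σ τ ^ k) (Sum.inl a) = Sum.inl b :=
  ⟨orderOf (walk σ τ), orderOf_pos _, a, by rw [pow_orderOf_eq_one]; rfl⟩

open Classical in
/-- The number of steps after which the walk issuing from `a` first reaches an element of `W`. -/
noncomputable def returnTime [Finite W] [Finite U] (σ : Equiv.Perm (W ⊕ U)) (τ : Equiv.Perm U)
    (a : W) : ℕ :=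
  Nat.find (exists_return σ τ a)

/-- The other end of the arc issuing from `a`, after the legs have been joined by `τ`. -/
noncomputable def glueFun [Finite W] [Finite U] (σ : Equiv.Perm (W ⊕ U)) (τ : Equiv.Perm U)
    (a : W) : W :=
  Classical.choose (p := fun b => (walk σ τ ^ returnTime σ τ a) (Sum.inl a) = Sum.inl b)
    (by classical exact (Nat.find_spec (exists_return σ τ a)).2)

theorem returnTime_pos [Finite W] [Finite U] (σ : Equiv.Perm (W ⊕ U)) (τ : Equiv.Perm U) (a : W) :
    0 < returnTime σ τ a := by
  classical exact (Nat.find_spec (exists_return σ τ a)).1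

theorem glueFun_spec [Finite W] [Finite U] (σ : Equiv.Perm (W ⊕ U)) (τ : Equiv.Perm U) (a : W) :
    (walk σ τ ^ returnTime σ τ a) (Sum.inl a) = Sum.inl (glueFun σ τ a) :=
  Classical.choose_spec (p := fun b => (walk σ τ ^ returnTime σ τ a) (Sum.inl a) = Sum.inl b) _

theorem returnTime_min [Finite W] [Finite U] (σ : Equiv.Perm (W ⊕ U)) (τ : Equiv.Perm U) (a : W)
    {k : ℕ} (hk : 0 < k) {b : W} (h : (walk σ τ ^ k) (Sum.inl a) = Sum.inl b) :
    returnTime σ τ a ≤ k := by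
  classical exact Nat.find_min' (exists_return σ τ a) ⟨hk, b, h⟩

theorem glueFun_eq [Finite W] [Finite U] (σ : Equiv.Perm (W ⊕ U)) (τ : Equiv.Perm U) (a b : W)
    {k : ℕ} (hk : 0 < k) (h : (walk σ τ ^ k) (Sum.inl a) = Sum.inl b)
    (hmin : ∀ j, 0 < j → j < k → ∀ c, (walk σ τ ^ j) (Sum.inl a) ≠ Sum.inl c) :
    glueFun σ τ a = b := by
  have h1 : returnTime σ τ a = k := by
    refine le_antisymm (returnTime_min σ τ a hk h) ?_
    by_contra hlt
    exact hmin _ (returnTime_pos σ τ a) (not_le.mp hlt) _ (glueFun_spec σ τ a)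
  have h2 := glueFun_spec σ τ a
  rw [h1, h] at h2
  exact (Sum.inl_injective h2).symm

theorem glueFun_of_edge [Finite W] [Finite U] (σ : Equiv.Perm (W ⊕ U)) (τ : Equiv.Perm U) (a b : W)
    (h : σ (Sum.inl a) = Sum.inl b) : glueFun σ τ a = b :=
  glueFun_eq σ τ a b (k := 1) one_pos (by simpa [walk] using h)
    (fun j h0 h1 => absurd h1 (by omega))

theorem reverse_step {σ : Equiv.Perm (W ⊕ U)} {τ : Equiv.Perm U} (hσ : IsMatching σ)
    (hτ : IsMatching τ) (x : W ⊕ U) :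
    walk σ τ (Equiv.sumCongr 1 τ (walk σ τ x)) = Equiv.sumCongr 1 τ x := by
  have h1 : ∀ y : W ⊕ U, Equiv.sumCongr (1 : Equiv.Perm W) τ (Equiv.sumCongr 1 τ y) = y := by
    rintro (a | i)
    · rfl
    · simp [hτ.1 i]
  simp only [walk, Equiv.Perm.mul_apply, h1, hσ.1]

theorem reverse_pow {σ : Equiv.Perm (W ⊕ U)} {τ : Equiv.Perm U} (hσ : IsMatching σ)
    (hτ : IsMatching τ) (k : ℕ) (x : W ⊕ U) :
    (walk σ τ ^ k) (Equiv.sumCongr 1 τ ((walk σ τ ^ k) x)) = Equiv.sumCongr 1 τ x := by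
  induction k generalizing x with
  | zero => rfl
  | succ k ih =>
    have h1 : ∀ y, (walk σ τ ^ (k + 1)) y = (walk σ τ ^ k) (walk σ τ y) := fun y => by
      rw [pow_succ, Equiv.Perm.mul_apply]
    have h2 : ∀ y, (walk σ τ ^ (k + 1)) y = walk σ τ ((walk σ τ ^ k) y) := fun y => by
      rw [pow_succ', Equiv.Perm.mul_apply]
    rw [h1 (Equiv.sumCongr 1 τ _), h2 x, reverse_step hσ hτ, ih]

theorem glueFun_invol [Finite W] [Finite U] {σ : Equiv.Perm (W ⊕ U)} {τ : Equiv.Perm U}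
    (hσ : IsMatching σ) (hτ : IsMatching τ) (a : W) : glueFun σ τ (glueFun σ τ a) = a := by
  have key : ∀ k (a b : W), (walk σ τ ^ k) (Sum.inl a) = Sum.inl b →
      (walk σ τ ^ k) (Sum.inl b) = Sum.inl a := by
    intro k a b h
    have := reverse_pow hσ hτ k (Sum.inl a)
    rw [h] at this
    exact this
  refine glueFun_eq σ τ _ a (returnTime_pos σ τ a) (key _ _ _ (glueFun_spec σ τ a)) ?_
  intro j h0 hj c hc
  -- the walk back from the far end reaches `c`, so the walk from `a` meets `c` too early
  obtain ⟨m, hm⟩ : ∃ m, returnTime σ τ a = m + j := ⟨_, (Nat.sub_add_cancel hj.le).symm⟩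
  have h1 := key _ _ _ hc
  have h2 := glueFun_spec σ τ a
  rw [hm, add_comm m j, pow_add, Equiv.Perm.mul_apply, ← h1] at h2
  have h3 := (walk σ τ ^ j).injective h2
  have := returnTime_min σ τ a (by omega : 0 < m) h3
  omega

theorem glueFun_ne [Finite W] [Finite U] {σ : Equiv.Perm (W ⊕ U)} {τ : Equiv.Perm U}
    (hσ : IsMatching σ) (hτ : IsMatching τ) (a : W) : glueFun σ τ a ≠ a := by
  intro h
  have hk := glueFun_spec σ τ a
  have hpos := returnTime_pos σ τ a
  rw [h] at hk
  rcases Nat.even_or_odd' (returnTime σ τ a) with ⟨j, hj | hj⟩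
  · have h1 := reverse_pow hσ hτ j (Sum.inl a)
    have h2 : (walk σ τ ^ j) ((walk σ τ ^ j) (Sum.inl a)) = Sum.inl a := by
      rw [← Equiv.Perm.mul_apply, ← pow_add, ← two_mul, ← hj, hk]
    have h3 := (walk σ τ ^ j).injective
      (h1.trans (show Equiv.sumCongr 1 τ (Sum.inl a) = _ from h2.symm))
    cases hx : (walk σ τ ^ j) (Sum.inl a) with
    | inl b =>
      have := returnTime_min σ τ a (by omega : 0 < j) hx
      omega
    | inr i =>
      rw [hx] at h3
      exact hτ.2 i (Sum.inr_injective h3)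
  · have h1 := reverse_pow hσ hτ j (Sum.inl a)
    have h2 : (walk σ τ ^ j) (walk σ τ ((walk σ τ ^ j) (Sum.inl a))) = Sum.inl a := by
      rw [← Equiv.Perm.mul_apply (walk σ τ), ← pow_succ', ← Equiv.Perm.mul_apply, ← pow_add]
      rw [show j + (j + 1) = returnTime σ τ a by omega, hk]
    have h3 := (walk σ τ ^ j).injective
      (h2.trans (show Sum.inl a = Equiv.sumCongr 1 τ (Sum.inl a) from rfl) |>.trans h1.symm)
    exact hσ.2 _ h3

/-- The edges of the graph obtained by joining the legs according to `τ`. -/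
noncomputable def glue [Finite W] [Finite U] (σ : Equiv.Perm (W ⊕ U)) (hσ : IsMatching σ)
    (τ : Equiv.Perm U) (hτ : IsMatching τ) : Equiv.Perm W :=
  Function.Involutive.toPerm (glueFun σ τ) (glueFun_invol hσ hτ)

/-- Being the two ends of an edge, or being two legs that are joined. -/
def Adjacent (σ : Equiv.Perm (W ⊕ U)) (τ : Equiv.Perm U) (x y : W ⊕ U) : Prop :=
  y = σ x ∨ y = Equiv.sumCongr 1 τ x

/-- The number of circles without vertices that arise when the legs are joined according to `τ`
(they are made of edges both of whose ends are legs). -/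
noncomputable def numCircles (σ : Equiv.Perm (W ⊕ U)) (τ : Equiv.Perm U) : ℕ :=
  Nat.card {q : Quot (Adjacent σ τ) // ∀ a : W, q ≠ Quot.mk _ (Sum.inl a)}

theorem walk_map {σ : Equiv.Perm (W ⊕ U)} {τ : Equiv.Perm U} {σ' : Equiv.Perm (W' ⊕ U')}
    {τ' : Equiv.Perm U'} (φ : W ≃ W') (ψ : U ≃ U')
    (hσ : ∀ x, σ' (Equiv.sumCongr φ ψ x) = Equiv.sumCongr φ ψ (σ x))
    (hτ : ∀ i, τ' (ψ i) = ψ (τ i)) (k : ℕ) (x : W ⊕ U) :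
    (walk σ' τ' ^ k) (Equiv.sumCongr φ ψ x) = Equiv.sumCongr φ ψ ((walk σ τ ^ k) x) := by
  induction k with
  | zero => rfl
  | succ k ih =>
    rw [pow_succ', pow_succ', Equiv.Perm.mul_apply, Equiv.Perm.mul_apply, ih]
    generalize (walk σ τ ^ k) x = y
    simp only [walk, Equiv.Perm.mul_apply, ← hσ]
    congr 1
    rcases y with a | i
    · rfl
    · simp [hτ]

theorem glueFun_map [Finite W] [Finite U] [Finite W'] [Finite U']
    {σ : Equiv.Perm (W ⊕ U)} {τ : Equiv.Perm U} {σ' : Equiv.Perm (W' ⊕ U')}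
    {τ' : Equiv.Perm U'} (φ : W ≃ W') (ψ : U ≃ U')
    (hσ : ∀ x, σ' (Equiv.sumCongr φ ψ x) = Equiv.sumCongr φ ψ (σ x))
    (hτ : ∀ i, τ' (ψ i) = ψ (τ i)) (a : W) :
    glueFun σ' τ' (φ a) = φ (glueFun σ τ a) := by
  refine glueFun_eq σ' τ' _ _ (returnTime_pos σ τ a) ?_ ?_
  · have := walk_map φ ψ hσ hτ (returnTime σ τ a) (Sum.inl a)
    rw [glueFun_spec] at this
    exact this
  · intro j h0 hj c hc
    have h1 := walk_map φ ψ hσ hτ j (Sum.inl a)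
    rw [show Equiv.sumCongr φ ψ (Sum.inl a) = Sum.inl (φ a) from rfl, hc] at h1
    have h2 : (walk σ τ ^ j) (Sum.inl a) = Sum.inl (φ.symm c) := by
      apply (Equiv.sumCongr φ ψ).injective
      rw [← h1]; simp
    have := returnTime_min σ τ a h0 h2
    omega

theorem numCircles_map {σ : Equiv.Perm (W ⊕ U)} {τ : Equiv.Perm U} {σ' : Equiv.Perm (W' ⊕ U')}
    {τ' : Equiv.Perm U'} (φ : W ≃ W') (ψ : U ≃ U')
    (hσ : ∀ x, σ' (Equiv.sumCongr φ ψ x) = Equiv.sumCongr φ ψ (σ x))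
    (hτ : ∀ i, τ' (ψ i) = ψ (τ i)) : numCircles σ' τ' = numCircles σ τ := by
  have hadj : ∀ x y, Adjacent σ τ x y ↔
      Adjacent σ' τ' (Equiv.sumCongr φ ψ x) (Equiv.sumCongr φ ψ y) := by
    intro x y
    have h2 : Equiv.sumCongr (1 : Equiv.Perm W') τ' (Equiv.sumCongr φ ψ x) =
        Equiv.sumCongr φ ψ (Equiv.sumCongr (1 : Equiv.Perm W) τ x) := by
      rcases x with a | i
      · rfl
      · simp [hτ]
    unfold Adjacent
    rw [hσ, h2, EmbeddingLike.apply_eq_iff_eq, EmbeddingLike.apply_eq_iff_eq]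
  symm
  refine Nat.card_congr ((Quot.congr (Equiv.sumCongr φ ψ) hadj).subtypeEquiv ?_)
  intro q
  constructor
  · intro h a' hq
    apply h (φ.symm a')
    apply (Quot.congr (Equiv.sumCongr φ ψ) hadj).injective
    rw [hq]
    change _ = Quot.mk _ (Equiv.sumCongr φ ψ (Sum.inl (φ.symm a')))
    simp
  · intro h a hq
    apply h (φ a)
    rw [hq]
    rfl

end Glue

/-! ### Chinese characters -/

/-- The ends of edges (half-edges) of a graph with trivalent vertices indexed by `Fin t` and
univalent vertices indexed by `Fin u`. -/
abbrev Flag (t u : ℕ) : Type := (Fin t × Fin 3) ⊕ Fin u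

/-- A Chinese character with `u` legs (univalent vertices): the three flags at the trivalent
vertex `v` are `(v, 0), (v, 1), (v, 2)`, in this cyclic order, and the edges are the pairs
`{x, pair x}` of flags. Loops, multiple edges and disconnected graphs are allowed. -/
structure Character (u : ℕ) where
  /-- the number of trivalent vertices -/
  t : ℕ
  /-- the edges -/
  pair : Equiv.Perm (Flag t u)
  isMatching : IsMatching pair

namespace Character

variable {u u' : ℕ}

/-- The bijection between flags at trivalent vertices given by a bijection `f` of the vertices
together with a rotation by `r v` of the three flags at each vertex `v`. -/
def vertexEquiv {t t' : ℕ} (f : Fin t ≃ Fin t') (r : Fin t → Fin 3) :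
    Fin t × Fin 3 ≃ Fin t' × Fin 3 :=
  Equiv.prodShear f fun v => Equiv.addRight (r v)

/-- Isomorphism of Chinese characters: bijections of the trivalent vertices, of the flags at them
and of the legs which preserve incidence, edges and cyclic orders. -/
def Iso (D E : Character u) : Prop :=
  ∃ (f : Fin D.t ≃ Fin E.t) (r : Fin D.t → Fin 3) (g : Equiv.Perm (Fin u)),
    ∀ x, E.pair (Equiv.sumCongr (vertexEquiv f r) g x) =
      Equiv.sumCongr (vertexEquiv f r) g (D.pair x)

theorem isMatching_conj {X Y : Type} (e : X ≃ Y) {σ : Equiv.Perm X} (h : IsMatching σ) :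
    IsMatching (e.permCongr σ) := by
  refine ⟨fun y => ?_, fun y hy => ?_⟩
  · simp [Equiv.permCongr_apply, h.1]
  · apply h.2 (e.symm y)
    rw [Equiv.permCongr_apply] at hy
    exact e.injective (by simpa using hy)

/-- Detach all edges from the trivalent vertices and reattach the end at `a` to the place
`g a`. -/
def reattach (D : Character u) (g : Equiv.Perm (Fin D.t × Fin 3)) : Character u where
  t := D.t
  pair := (Equiv.sumCongr g (1 : Equiv.Perm (Fin u))).permCongr D.pair
  isMatching := isMatching_conj _ D.isMatching

/-- The empty graph. -/
def empty : Character 0 where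
  t := 0
  pair := 1
  isMatching := ⟨fun _ => rfl, fun x => by rcases x with ⟨a, _⟩ | a <;> exact a.elim0⟩

/-- The evident identification of the flags of two graphs with the flags of their disjoint
union. -/
def flagSum (t t' u u' : ℕ) : Flag t u ⊕ Flag t' u' ≃ Flag (t + t') (u + u') :=
  (Equiv.sumSumSumComm _ _ _ _).trans
    (Equiv.sumCongr
      ((Equiv.sumProdDistrib _ _ _).symm.trans (Equiv.prodCongr finSumFinEquiv (Equiv.refl _)))
      finSumFinEquiv)

/-- Disjoint union of Chinese characters. -/
def disjointUnion (D : Character u) (E : Character u') : Character (u + u') where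
  t := D.t + E.t
  pair := (flagSum D.t E.t u u').permCongr (Equiv.sumCongr D.pair E.pair)
  isMatching := by
    apply isMatching_conj
    constructor
    · rintro (x | x)
      · simp [D.isMatching.1]
      · simp [E.isMatching.1]
    · rintro (x | x) h
      · exact D.isMatching.2 x (Sum.inl_injective h)
      · exact E.isMatching.2 x (Sum.inr_injective h)

/-- The edges of the wheel: the flag `(i, 0)` is joined to the `i`-th leg, and `(i, 1)` is joined
to `(i + 1, 2)`, where `i` is read modulo `k`. -/
def wheelFun (k : ℕ) : Flag k k → Flag k k
  | Sum.inl (i, 0) => Sum.inr i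
  | Sum.inl (i, 1) => Sum.inl (finRotate k i, 2)
  | Sum.inl (i, 2) => Sum.inl ((finRotate k).symm i, 1)
  | Sum.inr i => Sum.inl (i, 0)

theorem wheelFun_invol (k : ℕ) : Function.Involutive (wheelFun k) := by
  rintro (⟨i, j⟩ | i)
  · fin_cases j
    · rfl
    · exact congrArg (fun a => Sum.inl (a, (1 : Fin 3))) ((finRotate k).symm_apply_apply i)
    · exact congrArg (fun a => Sum.inl (a, (2 : Fin 3))) ((finRotate k).apply_symm_apply i)
  · rfl

/-- The wheel with `k` legs: a cycle of `k` trivalent vertices with one leg attached to each of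
them, all vertices having the same orientation. -/
def wheel (k : ℕ) : Character k where
  t := k
  pair := (wheelFun_invol k).toPerm
  isMatching := by
    refine ⟨wheelFun_invol k, ?_⟩
    rintro (⟨i, j⟩ | i)
    · fin_cases j <;> simp [wheelFun]
    · simp [wheelFun]

/-- Every component is a wheel: the character is isomorphic to a (possibly empty) disjoint union of
wheels with at least one leg each. -/
inductive IsWheels : ∀ {u : ℕ}, Character u → Prop
  | empty : IsWheels empty
  | union (k u : ℕ) (D : Character u) : 1 ≤ k → IsWheels D → IsWheels ((wheel k).disjointUnion D)
  | iso (u : ℕ) (D E : Character u) : IsWheels D → D.Iso E → IsWheels E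

/-- The trivalent graph obtained by joining the legs in pairs according to `τ` (leaving out
circles without vertices). -/
noncomputable def join (D : Character u) (τ : Equiv.Perm (Fin u)) (hτ : IsMatching τ) :
    Character 0 where
  t := D.t
  pair := Equiv.sumCongr (glue D.pair D.isMatching τ hτ) 1
  isMatching := by
    constructor
    · rintro (a | i)
      · exact congrArg Sum.inl (glueFun_invol D.isMatching hτ a)
      · exact i.elim0
    · rintro (a | i) h
      · exact glueFun_ne D.isMatching hτ a (Sum.inl_injective h)
      · exact i.elim0

end Character

/-- The cyclic permutation `a ↦ b ↦ c ↦ a` (for distinct `a`, `b`, `c`). -/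
def cyc {X : Type} [DecidableEq X] (a b c : X) : Equiv.Perm X :=
  Equiv.swap a b * Equiv.swap b c

/-- The relations between Chinese characters with `u` legs: isomorphic characters are identified;
antisymmetry: transposing two of the flags at a vertex changes the sign; IHX: for an edge with
ends `(v, i)`, `(w, j)` at two different vertices, the sum over the three cyclic permutations of
the flags `(v, i + 1)`, `(v, i + 2)`, `(w, j + 1)` vanishes, the flag `(w, j + 2)` being fixed. -/
inductive Relator (u : ℕ) : (Character u →₀ ℚ) → Prop
  | iso (D E : Character u) : D.Iso E →
      Relator u (Finsupp.single D 1 - Finsupp.single E 1)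
  | antisymmetry (D : Character u) (v : Fin D.t) (i j : Fin 3) : i ≠ j →
      Relator u (Finsupp.single (D.reattach (Equiv.swap (v, i) (v, j))) 1 + Finsupp.single D 1)
  | ihx (D : Character u) (v w : Fin D.t) (i j : Fin 3) : v ≠ w →
      D.pair (Sum.inl (v, i)) = Sum.inl (w, j) →
      Relator u (Finsupp.single D 1 +
        Finsupp.single (D.reattach (cyc (v, i + 1) (v, i + 2) (w, j + 1))) 1 +
        Finsupp.single (D.reattach (cyc (v, i + 1) (v, i + 2) (w, j + 1) *
          cyc (v, i + 1) (v, i + 2) (w, j + 1))) 1)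

/-- The rational vector space of Chinese characters with `u` legs modulo antisymmetry and IHX. -/
abbrev BLegs (u : ℕ) : Type :=
  (Character u →₀ ℚ) ⧸ Submodule.span ℚ {x | Relator u x}

/-- The class of a Chinese character with `u` legs. -/
noncomputable def cls {u : ℕ} (D : Character u) : BLegs u :=
  Submodule.Quotient.mk (Finsupp.single D 1)

/-- The space `𝓑` of Chinese characters modulo antisymmetry and IHX. The relations preserve the
number of legs, so it is the direct sum over the number of legs. -/
abbrev B : Type := ⨁ u : ℕ, BLegs u

/-- The class in `𝓑` of a Chinese character. -/
noncomputable def clsB {u : ℕ} (D : Character u) : B :=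
  DirectSum.lof ℚ ℕ BLegs u (cls D)

/-- The space `𝓐(∅)` of trivalent graphs with cyclic orders at the vertices, i.e. of Chinese
characters without legs, modulo antisymmetry and IHX. -/
abbrev AEmpty : Type := BLegs 0

/-- The degree `n` part of `𝓐(∅)`, spanned by the graphs with `2n` vertices. -/
noncomputable def AEmptyDeg (n : ℕ) : Submodule ℚ AEmpty :=
  Submodule.span ℚ {y | ∃ G : Character 0, G.t = 2 * n ∧ y = cls G}

/-- The subspace `𝓑_wh` spanned by the Chinese characters every component of which is a wheel. -/
noncomputable def BWheels : Submodule ℚ B :=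
  Submodule.span ℚ {x | ∃ (u : ℕ) (D : Character u), D.IsWheels ∧ x = clsB D}

/-- The degree `m` part of `𝓑_wh`; the degree of a Chinese character is half the number of its
vertices (trivalent and univalent). -/
noncomputable def BWheelsDeg (m : ℕ) : Submodule ℚ B :=
  Submodule.span ℚ {x | ∃ (u : ℕ) (D : Character u), D.IsWheels ∧ D.t + u = 2 * m ∧ x = clsB D}

/-! ### The closure map -/

/-- The closure of a Chinese character: the sum over all ways of joining its legs in pairs, where
circles without vertices are replaced by the number `z` (no such circle arises unless some component
of the character is an interval). -/
noncomputable def closeChar (z : ℚ) {u : ℕ} (D : Character u) : AEmpty :=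
  ∑ τ : {τ : Equiv.Perm (Fin u) // IsMatching τ},
    z ^ numCircles D.pair τ.1 • cls (D.join τ.1 τ.2)

theorem cls_eq_of_iso {u : ℕ} {D E : Character u} (h : D.Iso E) : cls D = cls E := by
  rw [cls, cls, Submodule.Quotient.eq]
  exact Submodule.subset_span (Relator.iso D E h)

theorem join_iso {u : ℕ} {D E : Character u} (f : Fin D.t ≃ Fin E.t) (r : Fin D.t → Fin 3)
    (g : Equiv.Perm (Fin u))
    (h : ∀ x, E.pair (Equiv.sumCongr (Character.vertexEquiv f r) g x) =
      Equiv.sumCongr (Character.vertexEquiv f r) g (D.pair x))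
    {τ τ' : Equiv.Perm (Fin u)} (hτ : IsMatching τ) (hτ' : IsMatching τ')
    (hg : ∀ i, τ' (g i) = g (τ i)) : (D.join τ hτ).Iso (E.join τ' hτ') := by
  refine ⟨f, r, 1, ?_⟩
  rintro (a | i)
  · exact congrArg Sum.inl (glueFun_map (Character.vertexEquiv f r) g h hg a)
  · exact i.elim0

theorem reattach_pair {u : ℕ} (D : Character u) (p : Equiv.Perm (Fin D.t × Fin 3))
    (x : Flag D.t u) :
    (D.reattach p).pair (Equiv.sumCongr p (Equiv.refl (Fin u)) x) =
      Equiv.sumCongr p (Equiv.refl (Fin u)) (D.pair x) := by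
  change (Equiv.sumCongr p (1 : Equiv.Perm (Fin u))).permCongr D.pair
    (Equiv.sumCongr p (1 : Equiv.Perm (Fin u)) x) = _
  rw [Equiv.permCongr_apply, Equiv.symm_apply_apply]
  rfl

theorem join_reattach {u : ℕ} (D : Character u) (p : Equiv.Perm (Fin D.t × Fin 3))
    {τ : Equiv.Perm (Fin u)} (hτ : IsMatching τ) :
    (D.reattach p).join τ hτ = (D.join τ hτ).reattach p := by
  have key : ∀ x, ((D.reattach p).join τ hτ).pair x = ((D.join τ hτ).reattach p).pair x := by
    intro x
    obtain ⟨y, rfl⟩ := (Equiv.sumCongr p (Equiv.refl (Fin 0))).surjective x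
    refine Eq.trans ?_ (reattach_pair (D.join τ hτ) p y).symm
    rcases y with a | i
    · exact congrArg Sum.inl (glueFun_map (σ := D.pair) (σ' := (D.reattach p).pair)
        (τ := τ) (τ' := τ) p
        (Equiv.refl (Fin u)) (reattach_pair D p) (fun _ => rfl) a)
    · exact i.elim0
  have h2 : ((D.reattach p).join τ hτ).pair = ((D.join τ hτ).reattach p).pair := Equiv.ext key
  have : ∀ (t : ℕ) (σ σ' : Equiv.Perm (Flag t 0)) (h : IsMatching σ) (h' : IsMatching σ'),
      σ = σ' → Character.mk t σ h = Character.mk t σ' h' := by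
    rintro t σ σ' h h' rfl
    rfl
  exact this D.t _ _ _ _ h2

theorem closeChar_reattach (z : ℚ) {u : ℕ} (D : Character u)
    (p : Equiv.Perm (Fin D.t × Fin 3)) :
    closeChar z (D.reattach p) = ∑ τ : {τ : Equiv.Perm (Fin u) // IsMatching τ},
      z ^ numCircles D.pair τ.1 • cls ((D.join τ.1 τ.2).reattach p) := by
  refine Finset.sum_congr rfl fun τ _ => ?_
  rw [join_reattach]
  congr 2
  exact numCircles_map (σ := D.pair) (σ' := (D.reattach p).pair) p
    (Equiv.refl (Fin u)) (reattach_pair D p) (fun _ => rfl)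

theorem closeChar_iso (z : ℚ) {u : ℕ} {D E : Character u} (h : D.Iso E) :
    closeChar z D = closeChar z E := by
  obtain ⟨f, r, g, hg⟩ := h
  refine Fintype.sum_equiv
    (g.permCongr.subtypeEquiv (p := IsMatching) (q := IsMatching) ?_) _ _ ?_
  · intro τ
    refine ⟨Character.isMatching_conj g, fun h => ?_⟩
    have := Character.isMatching_conj g.symm h
    rwa [← Equiv.permCongr_symm, Equiv.symm_apply_apply] at this
  · intro τ
    have hτ : ∀ i, g.permCongr τ.1 (g i) = g (τ.1 i) := by
      intro i
      simp
    have h1 := numCircles_map (σ := D.pair) (σ' := E.pair) _ g hg hτ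
    change z ^ numCircles D.pair τ.1 • cls (D.join τ.1 τ.2) =
      z ^ numCircles E.pair (g.permCongr τ.1) • cls (E.join (g.permCongr τ.1) (Character.isMatching_conj g τ.2))
    rw [h1, cls_eq_of_iso (join_iso f r g hg τ.2 (Character.isMatching_conj g τ.2) hτ)]

theorem closeChar_relator (z : ℚ) {u : ℕ} {x : Character u →₀ ℚ} (h : Relator u x) :
    Finsupp.linearCombination ℚ (closeChar z (u := u)) x = 0 := by
  cases h with
  | iso D E h => simp [closeChar_iso z h]
  | antisymmetry D v i j hij =>
    simp only [map_add, Finsupp.linearCombination_single, one_smul, closeChar_reattach]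
    rw [closeChar, ← Finset.sum_add_distrib]
    refine Finset.sum_eq_zero fun τ _ => ?_
    rw [← smul_add]
    have : cls ((D.join τ.1 τ.2).reattach (Equiv.swap (v, i) (v, j))) + cls (D.join τ.1 τ.2) = 0 :=
      (Submodule.Quotient.mk_eq_zero _).mpr
        (Submodule.subset_span (Relator.antisymmetry (D.join τ.1 τ.2) v i j hij))
    exact (congrArg _ this).trans (smul_zero _)
  | ihx D v w i j hvw hp =>
    simp only [map_add, Finsupp.linearCombination_single, one_smul, closeChar_reattach]
    rw [closeChar, ← Finset.sum_add_distrib, ← Finset.sum_add_distrib]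
    refine Finset.sum_eq_zero fun τ _ => ?_
    rw [← smul_add, ← smul_add]
    have hp' : (D.join τ.1 τ.2).pair (Sum.inl (v, i)) = Sum.inl (w, j) :=
      congrArg Sum.inl (glueFun_of_edge D.pair τ.1 (v, i) (w, j) hp)
    have := (Submodule.Quotient.mk_eq_zero _).mpr
      (Submodule.subset_span (R := ℚ) (Relator.ihx (D.join τ.1 τ.2) v w i j hvw hp'))
    exact (congrArg _ this).trans (smul_zero _)

/-- The closure map on Chinese characters with `u` legs. -/
noncomputable def closureLegs (z : ℚ) (u : ℕ) : BLegs u →ₗ[ℚ] AEmpty :=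
  Submodule.liftQ _ (Finsupp.linearCombination ℚ (closeChar z (u := u)))
    (Submodule.span_le.mpr fun _ h => closeChar_relator z h)

/-- The closure map `x ↦ ⟨x⟩` from `𝓑` to `𝓐(∅)`, circles without vertices being set equal to
`z`. -/
noncomputable def closure (z : ℚ) : B →ₗ[ℚ] AEmpty :=
  DirectSum.toModule ℚ ℕ AEmpty (closureLegs z)

theorem closure_clsB (z : ℚ) {u : ℕ} (D : Character u) : closure z (clsB D) = closeChar z D := by
  rw [closure, clsB, DirectSum.toModule_lof, closureLegs, cls]
  erw [Submodule.liftQ_apply]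
  simp

end JacobiDiagram

/-!
The proof evaluates trivalent graphs by weight systems: placing the structure constants of a
metrized Lie algebra at the vertices and contracting along the edges gives a number that respects
antisymmetry and IHX (`weightMap`) and is multiplicative under disjoint union
(`weight_disjointUnion`).

*Injectivity.* The Lie algebra is the direct sum of `m` copies of `so(3)`, the bracket of the
`j`-th copy being scaled by an indeterminate `X j`. For a Chinese character without intervals, let
the legs carry the coordinates of a generic vector `ξ` of the Lie algebra, which gives a
polynomial in `ξ`. Summing over all ways of joining the legs is, by Wick's theorem, the same as
taking the Gaussian expectation of this polynomial (`weightMap_closeChar`). A wheel gives the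
trace of a power of `ad ξ`; for `so(3)` this is the cross product with `ξ`, so the wheel with `2k`
legs gives `2 (-1)^k ∑ j, ρ_j ^ k` with `ρ_j = X_j² |ξ_j|²` (`weight_wheel_soTensor`). A
reflection shows that the classes of wheels with an odd number of legs vanish, so that every
element of `𝓑_wh` comes from a polynomial `F` in the wheels with even numbers of legs
(`BWheels_le_range`). If the weights of the closure vanish for all `m`, then `F = 0`, for two
reasons. First, the expectation of a monomial in the `ρ_j` is a positive multiple of the
corresponding monomial in the `X_j²`, so the expectation is injective on polynomials in the `ρ_j`
(`eq_zero_of_gaussian_aeval_normSq`). Second, the first `m` power sums in `m` variables are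
algebraically independent, their Jacobian being a Vandermonde determinant
(`eq_zero_of_aeval_psum_eq_zero`).

*Failure of surjectivity.* The argument shows more: an element of `𝓑_wh` is zero if all the
`so(3)`-weights of its closure vanish. Hence it suffices to find, in every degree `n ≥ 4`, a
nonzero element of `𝓐(∅)` that is killed by them. The cube and the Möbius ladder with four rungs
have degree `4`. Both are connected, so their weights for the direct sum are `∑ j, X_j ^ 8` times
their `so(3)`-weights `24` and `18`, and `3 · cube - 4 · ladder` is killed. It is not zero,
because the weights for `gl(3)` are `3024` and `1728`. Higher degrees are reached by adding theta
graphs, whose weight for `gl(3)` is not zero.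
-/

namespace JacobiDiagram

/-! ### Weight systems from structure tensors -/

section Weight

variable {I R : Type} [Fintype I] [DecidableEq I] [CommRing R] {u u' : ℕ}

/-- The colourings of the flags of `D` for which the two ends of every edge carry colours that are
exchanged by `s`. The colours stand for the elements of a basis of a metrized Lie algebra, and `s`
assigns to a basis element the one dual to it. -/
abbrev Coloring (s : I → I) (D : Character u) : Type :=
  {c : Flag D.t u → I // ∀ x, c (D.pair x) = s (c x)}

/-- The value of the tensor `f` on the colours of the three flags at the vertex `v`. -/
def vertexValue {t : ℕ} (f : I → I → I → R) (c : Fin t × Fin 3 → I) (v : Fin t) : R :=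
  f (c (v, 0)) (c (v, 1)) (c (v, 2))

/-- The state sum obtained by placing the tensor `f` at the trivalent vertices and the vector `y`
at the legs, and contracting along the edges. -/
def weight (s : I → I) (f : I → I → I → R) (y : I → R) (D : Character u) : R :=
  ∑ c : Coloring s D, (∏ v, vertexValue f (fun a => c.1 (Sum.inl a)) v) * ∏ i, y (c.1 (Sum.inr i))

/-- The tensor `f` consists of the structure constants of a Lie algebra with an invariant metric,
in a basis which `s` maps to the dual basis. -/
structure IsLieTensor (s : I → I) (f : I → I → I → R) : Prop where
  invol : ∀ a, s (s a) = a
  cyclic : ∀ a b c, f b c a = f a b c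
  antisymm : ∀ a b c, f a c b = -f a b c
  jacobi : ∀ a b c d,
    ∑ e, (f e a b * f (s e) c d + f e b c * f (s e) a d + f e c a * f (s e) b d) = 0

theorem weight_eq_sum_of_equiv {s : I → I} {f : I → I → I → R} {y : I → R}
    {D : Character u} {E : Character u'} (φ : Flag D.t u ≃ Flag E.t u')
    (hφ : ∀ x, E.pair (φ x) = φ (D.pair x)) :
    weight s f y E = ∑ c : Coloring s D,
      (∏ v, vertexValue f (fun a => c.1 (φ.symm (Sum.inl a))) v) *
        ∏ i, y (c.1 (φ.symm (Sum.inr i))) := by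
  symm
  refine Fintype.sum_equiv
    ((Equiv.arrowCongr φ (Equiv.refl I)).subtypeEquiv fun c => ?_) _ _ fun c => rfl
  simp only [Equiv.arrowCongr_apply, Equiv.coe_refl, Function.comp_apply, id_eq]
  constructor
  · intro h x
    rw [← h]
    congr 1
    rw [Equiv.symm_apply_eq, ← hφ, Equiv.apply_symm_apply]
  · intro h x
    have := h (φ x)
    rwa [hφ, Equiv.symm_apply_apply, Equiv.symm_apply_apply] at this

theorem weight_reattach (s : I → I) (f : I → I → I → R) (y : I → R) (D : Character u)
    (p : Equiv.Perm (Fin D.t × Fin 3)) :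
    weight s f y (D.reattach p) = ∑ c : Coloring s D,
      (∏ v, vertexValue f (fun a => c.1 (Sum.inl (p.symm a))) v) * ∏ i, y (c.1 (Sum.inr i)) :=
  weight_eq_sum_of_equiv (D := D) (E := D.reattach p)
    (Equiv.sumCongr p (Equiv.refl (Fin u))) (reattach_pair D p)

variable {s : I → I} {f : I → I → I → R} {y : I → R}

omit [DecidableEq I] in
theorem IsLieTensor.vertexValue_rotate (hf : IsLieTensor s f) {t : ℕ} (c : Fin t × Fin 3 → I)
    (v : Fin t) (i : Fin 3) :
    vertexValue f c v = f (c (v, i)) (c (v, i + 1)) (c (v, i + 2)) := by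
  fin_cases i
  · rfl
  · exact (hf.cyclic _ _ _).symm
  · exact hf.cyclic _ _ _

theorem weight_iso (hf : IsLieTensor s f) {D E : Character u} (h : D.Iso E) :
    weight s f y D = weight s f y E := by
  obtain ⟨g, r, p, hp⟩ := h
  rw [weight_eq_sum_of_equiv _ hp]
  refine Finset.sum_congr rfl fun c _ => ?_
  congr 1
  · refine Fintype.prod_equiv g _ _ fun v => ?_
    rw [hf.vertexValue_rotate _ (g v) (r v), hf.vertexValue_rotate _ v 0]
    have key : ∀ i : Fin 3, (Equiv.sumCongr (Character.vertexEquiv g r) p).symm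
        (Sum.inl (g v, i + r v)) = Sum.inl (v, i) := by
      intro i
      rw [Equiv.symm_apply_eq]
      rfl
    have h0 := key 0
    have h1 := key 1
    have h2 := key 2
    rw [zero_add] at h0
    rw [add_comm (r v) 1, add_comm (r v) 2, h0, h1, h2]
    rfl
  · exact Fintype.prod_equiv p _ _ fun i => by simp

theorem weight_antisymmetry (hf : IsLieTensor s f) (D : Character u) (v : Fin D.t) {i j : Fin 3}
    (hij : i ≠ j) :
    weight s f y (D.reattach (Equiv.swap (v, i) (v, j))) + weight s f y D = 0 := by
  rw [weight_reattach, weight, ← Finset.sum_add_distrib]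
  refine Finset.sum_eq_zero fun c _ => ?_
  rw [← add_mul]
  refine mul_eq_zero_of_left ?_ _
  rw [Fintype.prod_eq_mul_prod_compl v, Fintype.prod_eq_mul_prod_compl v]
  have h1 : ∏ w ∈ ({v}ᶜ : Finset (Fin D.t)),
      vertexValue f (fun a => c.1 (Sum.inl ((Equiv.swap (v, i) (v, j)).symm a))) w =
      ∏ w ∈ ({v}ᶜ : Finset (Fin D.t)), vertexValue f (fun a => c.1 (Sum.inl a)) w := by
    refine Finset.prod_congr rfl fun w hw => ?_
    have hw' : w ≠ v := by simpa using hw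
    simp [vertexValue, Equiv.swap_apply_of_ne_of_ne, hw']
  rw [h1, ← add_mul]
  refine mul_eq_zero_of_left ?_ _
  have e1 := hf.antisymm
  have e2 := hf.cyclic
  have h01 : ∀ a b c, f b a c = -f a b c := fun a b c => by rw [e2 c b a, e1 c a b, e2 c a b]
  have h02 : ∀ a b c, f c b a = -f a b c := fun a b c => by rw [e1 c a b, e2 b c a, e2 a b c]
  fin_cases i <;> fin_cases j <;>
    simp [vertexValue, Equiv.swap_apply_def, e1 _ (c.1 (Sum.inl (v, 1))),
      h01 (c.1 (Sum.inl (v, 0))), h02 (c.1 (Sum.inl (v, 0)))] at hij ⊢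

/-- Changing the colour of the edge at the flag `x`. -/
def Coloring.recolor {D : Character u} (hs : ∀ a, s (s a) = a) (x : Flag D.t u) (e : I)
    (c : Coloring s D) : Coloring s D :=
  ⟨Function.update (Function.update c.1 (D.pair x) (s e)) x e, fun z => by
    have hx : D.pair x ≠ x := D.isMatching.2 x
    by_cases h1 : z = x
    · subst h1
      simp [hx]
    · by_cases h2 : z = D.pair x
      · subst h2
        simp [D.isMatching.1, hx, hs]
      · have h3 : D.pair z ≠ x := fun h => h2 (by rw [← h, D.isMatching.1])
        simp [h1, h2, h3, c.2 z]⟩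

omit [Fintype I] [DecidableEq I] in
theorem Coloring.recolor_recolor {D : Character u} (hs : ∀ a, s (s a) = a) (x : Flag D.t u) (e : I)
    (c : Coloring s D) : (c.recolor hs x e).recolor hs x (c.1 x) = c := by
  have hx : D.pair x ≠ x := D.isMatching.2 x
  apply Subtype.ext
  funext z
  by_cases h1 : z = x
  · subst h1
    simp [recolor]
  · by_cases h2 : z = D.pair x
    · subst h2
      simp [recolor, hx, c.2]
    · simp [recolor, h1, h2]

/-- A sum over colourings vanishes if it vanishes whenever only the colour of one fixed edge
varies. -/
theorem sum_coloring_eq_zero [Algebra ℚ R] {D : Character u} (hs : ∀ a, s (s a) = a)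
    (x : Flag D.t u) (F : Coloring s D → R)
    (h : ∀ c : Coloring s D, ∑ e, F (c.recolor hs x e) = 0) :
    ∑ c, F c = 0 := by
  -- averaging over the colour of the edge does not change the sum
  have key : ∑ q : Coloring s D × I, F (q.1.recolor hs x q.2) = ∑ q : Coloring s D × I, F q.1 := by
    refine Fintype.sum_equiv (Function.Involutive.toPerm
      (fun q : Coloring s D × I => (q.1.recolor hs x q.2, q.1.1 x)) ?_) _ _ fun q => rfl
    intro q
    refine Prod.ext (Coloring.recolor_recolor hs x q.2 q.1) ?_
    simp [Coloring.recolor]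
  rw [Fintype.sum_prod_type, Finset.sum_eq_zero fun c _ => h c, Fintype.sum_prod_type] at key
  simp only [Finset.sum_const, ← Finset.smul_sum] at key
  rw [← Nat.cast_smul_eq_nsmul ℚ] at key
  rcases smul_eq_zero.mp key.symm with h0 | h0
  · have : IsEmpty I := by
      rw [← Fintype.card_eq_zero_iff]
      exact_mod_cast h0
    have : IsEmpty (Coloring s D) := ⟨fun c => this.elim (c.1 x)⟩
    simp
  · exact h0

/-- The IHX relation is the Jacobi identity at the colour of the edge between `v` and `w`, summed
over the other colours. -/
theorem weight_ihx [Algebra ℚ R] (hf : IsLieTensor s f) (D : Character u) (v w : Fin D.t)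
    (i j : Fin 3) (hvw : v ≠ w) (hp : D.pair (Sum.inl (v, i)) = Sum.inl (w, j)) :
    weight s f y D + weight s f y (D.reattach (cyc (v, i + 1) (v, i + 2) (w, j + 1))) +
      weight s f y (D.reattach (cyc (v, i + 1) (v, i + 2) (w, j + 1) *
        cyc (v, i + 1) (v, i + 2) (w, j + 1))) = 0 := by
  set q := cyc (v, i + 1) (v, i + 2) (w, j + 1) with hq
  have hi : ∀ k : Fin 3, k ≠ k + 1 ∧ k ≠ k + 2 ∧ k + 1 ≠ k + 2 := by decide
  -- the permutation `q` acts on three flags as a cycle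
  have qa : q.symm (v, i + 1) = (w, j + 1) := by
    rw [Equiv.symm_apply_eq, hq]
    simp [cyc]
  have qb : q.symm (v, i + 2) = (v, i + 1) := by
    rw [Equiv.symm_apply_eq, hq]
    simp [cyc, Equiv.swap_apply_def, hvw]
  have qd : q.symm (w, j + 1) = (v, i + 2) := by
    rw [Equiv.symm_apply_eq, hq]
    simp [cyc, Equiv.swap_apply_def, hvw.symm]
  have qo : ∀ a, a ≠ (v, i + 1) → a ≠ (v, i + 2) → a ≠ (w, j + 1) → q.symm a = a := by
    intro a h1 h2 h3
    rw [Equiv.symm_apply_eq, hq]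
    simp [cyc, Equiv.swap_apply_def, h1, h2, h3]
  have hprod : ∀ (p : Equiv.Perm (Fin D.t × Fin 3)) (c : Fin D.t × Fin 3 → I),
      (∀ a, a ≠ (v, i + 1) → a ≠ (v, i + 2) → a ≠ (w, j + 1) → p.symm a = a) →
      ∏ x, vertexValue f (fun a => c (p.symm a)) x =
        f (c (v, i)) (c (p.symm (v, i + 1))) (c (p.symm (v, i + 2))) *
        f (c (w, j)) (c (p.symm (w, j + 1))) (c (w, j + 2)) *
        ∏ x ∈ ({v, w}ᶜ : Finset (Fin D.t)), vertexValue f c x := by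
    intro p c h
    rw [← Finset.prod_mul_prod_compl {v, w}, Finset.prod_pair hvw]
    congr 1
    · rw [hf.vertexValue_rotate _ v i, hf.vertexValue_rotate _ w j]
      rw [h (v, i), h (w, j), h (w, j + 2)] <;>
        simp [hvw, hvw.symm, (hi i).1, (hi i).2.1, (hi j).1, (hi j).2.2.symm]
    · refine Finset.prod_congr rfl fun x hx => ?_
      have hx' : x ≠ v ∧ x ≠ w := by simpa using hx
      simp [vertexValue, h, hx'.1, hx'.2]
  have h1 : weight s f y D = weight s f y (D.reattach 1) := by
    rw [weight_reattach]
    rfl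
  rw [h1, weight_reattach, weight_reattach, weight_reattach, ← Finset.sum_add_distrib,
    ← Finset.sum_add_distrib]
  refine sum_coloring_eq_zero hf.invol (Sum.inl (v, i)) _ fun c => ?_
  simp only [← add_mul]
  have hy : ∀ e k, (c.recolor hf.invol (Sum.inl (v, i)) e).1 (Sum.inr k) = c.1 (Sum.inr k) := by
    intro e k
    simp [Coloring.recolor, hp]
  have ho : ∀ e a, a ≠ (v, i) → a ≠ (w, j) →
      (c.recolor hf.invol (Sum.inl (v, i)) e).1 (Sum.inl a) = c.1 (Sum.inl a) := by
    intro e a h1 h2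
    simp [Coloring.recolor, hp, h1, h2]
  have hv : ∀ e, (c.recolor hf.invol (Sum.inl (v, i)) e).1 (Sum.inl (v, i)) = e := by
    intro e
    simp [Coloring.recolor]
  have hw : ∀ e, (c.recolor hf.invol (Sum.inl (v, i)) e).1 (Sum.inl (w, j)) = s e := by
    intro e
    simp [Coloring.recolor, hp, hvw.symm]
  simp only [hy]
  rw [← Finset.sum_mul]
  refine mul_eq_zero_of_left ?_ _
  have hsum : ∀ e, (∏ x, vertexValue f (fun a => (c.recolor hf.invol (Sum.inl (v, i)) e).1
        (Sum.inl ((1 : Equiv.Perm (Fin D.t × Fin 3)).symm a))) x) +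
      (∏ x, vertexValue f (fun a =>
        (c.recolor hf.invol (Sum.inl (v, i)) e).1 (Sum.inl (q.symm a))) x) +
      (∏ x, vertexValue f (fun a =>
        (c.recolor hf.invol (Sum.inl (v, i)) e).1 (Sum.inl ((q * q).symm a))) x) =
      (f e (c.1 (Sum.inl (v, i + 1))) (c.1 (Sum.inl (v, i + 2))) *
          f (s e) (c.1 (Sum.inl (w, j + 1))) (c.1 (Sum.inl (w, j + 2))) +
        f e (c.1 (Sum.inl (v, i + 2))) (c.1 (Sum.inl (w, j + 1))) *
          f (s e) (c.1 (Sum.inl (v, i + 1))) (c.1 (Sum.inl (w, j + 2))) +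
        f e (c.1 (Sum.inl (w, j + 1))) (c.1 (Sum.inl (v, i + 1))) *
          f (s e) (c.1 (Sum.inl (v, i + 2))) (c.1 (Sum.inl (w, j + 2)))) *
        ∏ x ∈ ({v, w}ᶜ : Finset (Fin D.t)), vertexValue f (fun a => c.1 (Sum.inl a)) x := by
    intro e
    have hqq : ∀ a, (q * q).symm a = q.symm (q.symm a) := fun a => by
      rw [Equiv.symm_apply_eq, Equiv.Perm.mul_apply, Equiv.apply_symm_apply, Equiv.apply_symm_apply]
    have hrest : ∏ x ∈ ({v, w}ᶜ : Finset (Fin D.t)), vertexValue f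
        (fun a => (c.recolor hf.invol (Sum.inl (v, i)) e).1 (Sum.inl a)) x =
        ∏ x ∈ ({v, w}ᶜ : Finset (Fin D.t)), vertexValue f (fun a => c.1 (Sum.inl a)) x := by
      refine Finset.prod_congr rfl fun x hx => ?_
      have hx' : x ≠ v ∧ x ≠ w := by simpa using hx
      simp [vertexValue, ho, hx'.1, hx'.2]
    have a1 := ho e (v, i + 1) (by simp [(hi i).1.symm]) (by simp [hvw])
    have a2 := ho e (v, i + 2) (by simp [(hi i).2.1.symm]) (by simp [hvw])
    have a3 := ho e (w, j + 1) (by simp [hvw.symm]) (by simp [(hi j).1.symm])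
    have a4 := ho e (w, j + 2) (by simp [hvw.symm]) (by simp [(hi j).2.1.symm])
    rw [hprod 1 (fun a => (c.recolor hf.invol (Sum.inl (v, i)) e).1 (Sum.inl a))
        (fun _ _ _ _ => rfl),
      hprod q (fun a => (c.recolor hf.invol (Sum.inl (v, i)) e).1 (Sum.inl a)) qo,
      hprod (q * q) (fun a => (c.recolor hf.invol (Sum.inl (v, i)) e).1 (Sum.inl a))
        (fun a h1 h2 h3 => by rw [hqq, qo a h1 h2 h3, qo a h1 h2 h3]),
      hrest]
    have hone : ∀ a, (1 : Equiv.Perm (Fin D.t × Fin 3)).symm a = a := fun _ => rfl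
    simp only [hqq, qa, qb, qd, hone, hv, hw, a1, a2, a3, a4]
    ring
  rw [Finset.sum_congr rfl fun e _ => hsum e, ← Finset.sum_mul, hf.jacobi, zero_mul]

/-- The linear map on Chinese characters modulo the relations given by a metrized Lie algebra. -/
noncomputable def weightMap [Algebra ℚ R] (hf : IsLieTensor s f) (y : I → R) (u : ℕ) :
    BLegs u →ₗ[ℚ] R :=
  Submodule.liftQ _ (Finsupp.linearCombination ℚ (weight s f y (u := u)))
    (Submodule.span_le.mpr fun x h => by
      change Finsupp.linearCombination ℚ (weight s f y (u := u)) x = 0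
      cases h with
      | iso D E h => simp [weight_iso hf h]
      | antisymmetry D v i j hij => simpa using weight_antisymmetry hf D v hij
      | ihx D v w i j hvw hp => simpa using weight_ihx hf D v w i j hvw hp)

theorem weightMap_cls [Algebra ℚ R] (hf : IsLieTensor s f) (y : I → R) (D : Character u) :
    weightMap hf y u (cls D) = weight s f y D := by
  rw [weightMap, cls]
  erw [Submodule.liftQ_apply]
  simp

end Weight

/-! ### Weights of disjoint unions -/

section DisjointUnion

variable {u u' : ℕ}

theorem disjointUnion_pair (D : Character u) (E : Character u') (z : Flag D.t u ⊕ Flag E.t u') :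
    (D.disjointUnion E).pair (Character.flagSum D.t E.t u u' z) =
      Character.flagSum D.t E.t u u' (Equiv.sumCongr D.pair E.pair z) := by
  change (Character.flagSum D.t E.t u u').permCongr (Equiv.sumCongr D.pair E.pair) _ = _
  rw [Equiv.permCongr_apply, Equiv.symm_apply_apply]

variable (t t' : ℕ)

theorem flagSum_inl_inl (v : Fin t) (i : Fin 3) :
    Character.flagSum t t' u u' (Sum.inl (Sum.inl (v, i))) = Sum.inl (Fin.castAdd t' v, i) := rfl

theorem flagSum_inl_inr (k : Fin u) :
    Character.flagSum t t' u u' (Sum.inl (Sum.inr k)) = Sum.inr (Fin.castAdd u' k) := rfl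

theorem flagSum_inr_inl (v : Fin t') (i : Fin 3) :
    Character.flagSum t t' u u' (Sum.inr (Sum.inl (v, i))) = Sum.inl (Fin.natAdd t v, i) := rfl

theorem flagSum_inr_inr (k : Fin u') :
    Character.flagSum t t' u u' (Sum.inr (Sum.inr k)) = Sum.inr (Fin.natAdd u k) := rfl

end DisjointUnion

section Weight

variable {I J R S : Type} [Fintype I] [DecidableEq I] [Fintype J] [DecidableEq J] [CommRing R]
  [CommRing S] {u u' : ℕ}

omit [Fintype I] [DecidableEq I] in
theorem coloring_disjointUnion_iff {s : I → I} {D : Character u} {E : Character u'}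
    (c : Flag D.t u → I) (d : Flag E.t u' → I) :
    (∀ x, (Sum.elim c d) ((Character.flagSum D.t E.t u u').symm ((D.disjointUnion E).pair x)) =
      s ((Sum.elim c d) ((Character.flagSum D.t E.t u u').symm x))) ↔
    (∀ x, c (D.pair x) = s (c x)) ∧ ∀ x, d (E.pair x) = s (d x) := by
  have key : ∀ z, (Character.flagSum D.t E.t u u').symm ((D.disjointUnion E).pair
      (Character.flagSum D.t E.t u u' z)) = Equiv.sumCongr D.pair E.pair z := by
    intro z
    rw [disjointUnion_pair]
    exact Equiv.symm_apply_apply _ _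
  constructor
  · intro h
    constructor
    · intro x
      simpa [key] using h (Character.flagSum D.t E.t u u' (Sum.inl x))
    · intro x
      simpa [key] using h (Character.flagSum D.t E.t u u' (Sum.inr x))
  · rintro ⟨h1, h2⟩ x
    obtain ⟨z, rfl⟩ := (Character.flagSum D.t E.t u u').surjective x
    rw [key]
    rcases z with z | z
    · simpa using h1 z
    · simpa using h2 z

theorem weight_disjointUnion (s : I → I) (f : I → I → I → R) (y : I → R) (D : Character u)
    (E : Character u') :
    weight s f y (D.disjointUnion E) = weight s f y D * weight s f y E := by
  rw [weight, weight, weight, Finset.sum_mul_sum, ← Fintype.sum_prod_type']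
  symm
  let e : (Flag D.t u → I) × (Flag E.t u' → I) ≃ (Flag (D.t + E.t) (u + u') → I) :=
    (Equiv.sumArrowEquivProdArrow _ _ _).symm.trans
      (Equiv.arrowCongr (Character.flagSum D.t E.t u u') (Equiv.refl I))
  refine Fintype.sum_equiv ((Equiv.subtypeProdEquivProd (p := fun c : Flag D.t u → I =>
      ∀ x, c (D.pair x) = s (c x)) (q := fun d : Flag E.t u' → I =>
      ∀ x, d (E.pair x) = s (d x))).symm.trans (e.subtypeEquiv fun p =>
        (coloring_disjointUnion_iff p.1 p.2).symm)) _ _ ?_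
  rintro ⟨c, d⟩
  change _ = (∏ v : Fin (D.t + E.t), vertexValue f (fun a => (Sum.elim c.1 d.1)
    ((Character.flagSum D.t E.t u u').symm (Sum.inl a))) v) *
    ∏ i : Fin (u + u'), y ((Sum.elim c.1 d.1) ((Character.flagSum D.t E.t u u').symm (Sum.inr i)))
  rw [Fin.prod_univ_add, Fin.prod_univ_add]
  simp only [vertexValue, ← flagSum_inl_inl, ← flagSum_inl_inr, ← flagSum_inr_inl,
    ← flagSum_inr_inr, Equiv.symm_apply_apply, Sum.elim_inl, Sum.elim_inr]
  ring

theorem weight_empty (s : I → I) (f : I → I → I → R) (y : I → R) :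
    weight s f y Character.empty = 1 := by
  have : IsEmpty (Flag Character.empty.t 0) :=
    ⟨fun x => by rcases x with ⟨a, _⟩ | a <;> exact a.elim0⟩
  have : Unique (Coloring s Character.empty) :=
    { default := ⟨fun x => isEmptyElim x, fun x => isEmptyElim x⟩
      uniq := fun c => Subtype.ext (funext fun x => isEmptyElim x) }
  rw [weight, Fintype.sum_unique]
  have : IsEmpty (Fin Character.empty.t) := ⟨fun v => v.elim0⟩
  simp

theorem map_weight (φ : R →+* S) (s : I → I) (f : I → I → I → R) (y : I → R) (D : Character u) :
    weight s (fun a b c => φ (f a b c)) (fun a => φ (y a)) D = φ (weight s f y D) := by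
  simp [weight, vertexValue, map_sum, map_prod]

/-- The state sum of a product of two tensors factors. -/
theorem weight_prod (f : I → I → I → R) (g : J → J → J → R) (D : Character 0) (y : I × J → R)
    (y₁ : I → R) (y₂ : J → R) :
    weight id (fun a b c => f a.1 b.1 c.1 * g a.2 b.2 c.2) y D =
      weight id f y₁ D * weight id g y₂ D := by
  rw [weight, weight, weight, Finset.sum_mul_sum, ← Fintype.sum_prod_type']
  let e : (Flag D.t 0 → I × J) ≃ (Flag D.t 0 → I) × (Flag D.t 0 → J) :=
    Equiv.arrowProdEquivProdArrow _ _ _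
  refine Fintype.sum_equiv ((e.subtypeEquiv fun p => ?_).trans
    (Equiv.subtypeProdEquivProd (p := fun c : Flag D.t 0 → I =>
      ∀ x, c (D.pair x) = id (c x)) (q := fun d : Flag D.t 0 → J =>
      ∀ x, d (D.pair x) = id (d x)))) _ _ ?_
  · simp only [e, id_eq, Equiv.arrowProdEquivProdArrow_apply, Prod.ext_iff, ← forall_and]
  · intro c
    simp [vertexValue, e, Finset.prod_mul_distrib]
    rfl

end Weight

/-! ### The Gaussian functional -/

section Gaussian

variable {I R S : Type}

/-- The number of perfect matchings of a set with `α a` points of each colour `a` which match only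
points of equal colours. -/
noncomputable def matchingCount (α : I →₀ ℕ) : ℕ :=
  Nat.card {τ : Equiv.Perm (Σ a, Fin (α a)) // IsMatching τ ∧ ∀ x, (τ x).1 = x.1}

/-- The linear functional on polynomials which takes a monomial to the number of matchings of its
factors into pairs of equal variables. By Wick's theorem it is the expectation for independent
standard Gaussian variables. -/
noncomputable def gaussian [CommSemiring R] : MvPolynomial I R →ₗ[R] R :=
  (MvPolynomial.basisMonomials I R).constr R fun α => (matchingCount α : R)

theorem gaussian_monomial [CommSemiring R] (α : I →₀ ℕ) (r : R) :
    gaussian (MvPolynomial.monomial α r) = r * matchingCount α := by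
  have h := (MvPolynomial.basisMonomials I R).constr_basis R
    (fun α => (matchingCount α : R)) α
  rw [MvPolynomial.coe_basisMonomials] at h
  have h2 : MvPolynomial.monomial α r = r • MvPolynomial.monomial α (1 : R) := by
    rw [MvPolynomial.smul_monomial, smul_eq_mul, mul_one]
  rw [h2, map_smul, smul_eq_mul]
  exact congrArg (r * ·) h

theorem gaussian_map [CommSemiring R] [CommSemiring S] (φ : R →+* S) (p : MvPolynomial I R) :
    gaussian (MvPolynomial.map φ p) = φ (gaussian p) := by
  induction p using MvPolynomial.induction_on' with
  | monomial α r => simp [gaussian_monomial]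
  | add p q hp hq => simp [hp, hq]

theorem gaussian_prod_X [CommSemiring R] [DecidableEq I] {u : ℕ} (x : Fin u → I) :
    gaussian (∏ i, MvPolynomial.X (R := R) (x i)) =
      (Fintype.card {τ : Equiv.Perm (Fin u) // IsMatching τ ∧ ∀ i, x (τ i) = x i} : R) := by
  have h1 : ∏ i, MvPolynomial.X (R := R) (x i) =
      MvPolynomial.monomial (∑ i, Finsupp.single (x i) 1) 1 := by
    rw [MvPolynomial.monomial_sum_one]
    rfl
  rw [h1, gaussian_monomial, one_mul, matchingCount]
  congr 1
  rw [← Nat.card_eq_fintype_card]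
  set α : I →₀ ℕ := ∑ i, Finsupp.single (x i) 1 with hα
  have hcard : ∀ a, Fintype.card {i // x i = a} = α a := by
    intro a
    simp [hα, Finsupp.finsetSum_apply, Finsupp.single_apply, Fintype.card_subtype]
  let e : Fin u ≃ Σ a, Fin (α a) := (Equiv.sigmaFiberEquiv x).symm.trans
    (Equiv.sigmaCongrRight fun a => Fintype.equivFinOfCardEq (hcard a))
  have he : ∀ i, (e i).1 = x i := fun i => rfl
  refine (Nat.card_congr (e.permCongr.subtypeEquiv fun τ => ?_)).symm
  constructor
  · rintro ⟨h, h'⟩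
    refine ⟨Character.isMatching_conj e h, fun z => ?_⟩
    obtain ⟨i, rfl⟩ := e.surjective z
    rw [Equiv.permCongr_apply, Equiv.symm_apply_apply, he, he, h']
  · rintro ⟨h, h'⟩
    refine ⟨?_, fun i => ?_⟩
    · have := Character.isMatching_conj e.symm h
      rwa [← Equiv.permCongr_symm, Equiv.symm_apply_apply] at this
    · have := h' (e i)
      rwa [Equiv.permCongr_apply, Equiv.symm_apply_apply, he, he] at this

/-- Reversing the order within each colour class of even size is a matching. -/
theorem matchingCount_two_nsmul_pos [Finite I] (α : I →₀ ℕ) : 0 < matchingCount (2 • α) := by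
  let F : (Σ a, Fin ((2 • α) a)) → Σ a, Fin ((2 • α) a) := fun x => ⟨x.1, Fin.rev x.2⟩
  have hF : Function.Involutive F := by
    rintro ⟨a, k⟩
    exact Sigma.ext rfl (heq_of_eq (Fin.rev_rev k))
  rw [matchingCount, Nat.card_pos_iff]
  refine ⟨⟨hF.toPerm, ⟨hF, ?_⟩, fun x => rfl⟩, inferInstance⟩
  rintro ⟨a, k⟩ h
  have h1 : Fin.rev k = k :=
    eq_of_heq (Sigma.mk.inj_iff.mp (show F ⟨a, k⟩ = ⟨a, k⟩ from h)).2
  have h2 := congrArg Fin.val h1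
  have h3 : (2 • α) a = 2 * α a := rfl
  rw [Fin.val_rev] at h2
  omega

/-- The Gaussian functional does not vanish on nonzero polynomials in the squares of the variables
with natural coefficients. -/
theorem gaussian_expand_ne_zero [Finite I] {p : MvPolynomial I ℕ} (hp : p ≠ 0) :
    gaussian (MvPolynomial.expand 2 p) ≠ 0 := by
  have key : gaussian (MvPolynomial.expand 2 p) =
      ∑ α ∈ p.support, p.coeff α * matchingCount (2 • α) := by
    conv_lhs => rw [p.as_sum]
    rw [map_sum, map_sum]
    refine Finset.sum_congr rfl fun α _ => ?_
    rw [MvPolynomial.expand_monomial, gaussian_monomial]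
    rfl
  rw [key]
  obtain ⟨α, hα⟩ := MvPolynomial.support_nonempty.mpr hp
  refine (Finset.sum_pos' (fun _ _ => Nat.zero_le _) ⟨α, hα, ?_⟩).ne'
  exact Nat.mul_pos (Nat.pos_of_ne_zero (MvPolynomial.mem_support_iff.mp hα))
    (matchingCount_two_nsmul_pos α)

end Gaussian

/-! ### Weights of closures -/

section Closure

variable {u : ℕ}

/-- Every leg is attached to a trivalent vertex, i.e. no component is an interval. -/
def NoInterval (D : Character u) : Prop :=
  ∀ i, ∃ a, D.pair (Sum.inr i) = Sum.inl a

theorem NoInterval.numCircles_eq_zero {D : Character u} (hD : NoInterval D)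
    (τ : Equiv.Perm (Fin u)) : numCircles D.pair τ = 0 := by
  rw [numCircles]
  have : IsEmpty {q : Quot (Adjacent D.pair τ) // ∀ a, q ≠ Quot.mk _ (Sum.inl a)} := by
    refine ⟨fun q => ?_⟩
    obtain ⟨q, hq⟩ := q
    induction q using Quot.ind with
    | mk x =>
      rcases x with a | i
      · exact hq a rfl
      · obtain ⟨a, ha⟩ := hD i
        exact hq a (Quot.sound (Or.inl ha.symm))
  exact Nat.card_of_isEmpty

theorem glueFun_of_leg {W U : Type} [Finite W] [Finite U] (σ : Equiv.Perm (W ⊕ U))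
    (τ : Equiv.Perm U) {a b : W} {i : U} (h : σ (Sum.inl a) = Sum.inr i)
    (h' : σ (Sum.inr (τ i)) = Sum.inl b) : glueFun σ τ a = b := by
  have h1 : walk σ τ (Sum.inl a) = Sum.inr i := by simpa [walk] using h
  refine glueFun_eq σ τ a b (k := 2) two_pos ?_ ?_
  · rw [pow_two, Equiv.Perm.mul_apply, h1]
    simpa [walk] using h'
  · intro j h0 h2 c hc
    obtain rfl : j = 1 := by omega
    rw [pow_one, h1] at hc
    cases hc

variable {I R : Type} [Fintype I] [DecidableEq I] [CommRing R]

/-- Colourings of the graph obtained by joining legs are the colourings of the original graph for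
which joined legs have the same colour. -/
theorem weight_join (f : I → I → I → R) (y : I → R) {D : Character u} (hD : NoInterval D)
    {τ : Equiv.Perm (Fin u)} (hτ : IsMatching τ) :
    weight id f y (D.join τ hτ) = ∑ c : Coloring id D,
      if ∀ i, c.1 (Sum.inr (τ i)) = c.1 (Sum.inr i) then
        ∏ v, vertexValue f (fun a => c.1 (Sum.inl a)) v else 0 := by
  choose w hw using hD
  have hw' : ∀ i, D.pair (Sum.inl (w i)) = Sum.inr i := fun i => by rw [← hw, D.isMatching.1]
  have hglue : ∀ i, glueFun D.pair τ (w i) = w (τ i) := fun i =>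
    glueFun_of_leg D.pair τ (hw' i) (hw (τ i))
  have hcol : ∀ c : Coloring (id : I → I) (D.join τ hτ), ∀ a,
      c.1 (Sum.inl (glueFun D.pair τ a)) = c.1 (Sum.inl a) := fun c a => c.2 (Sum.inl a)
  rw [← Finset.sum_filter, weight]
  symm
  refine Finset.sum_bij' (s := Finset.univ.filter fun c : Coloring id D =>
      ∀ i, c.1 (Sum.inr (τ i)) = c.1 (Sum.inr i)) (t := Finset.univ)
    (fun c hc => ⟨Sum.elim (fun a => c.1 (Sum.inl a)) Fin.elim0, ?_⟩)
    (fun c _ => ⟨Sum.elim (fun a => c.1 (Sum.inl a)) (fun i => c.1 (Sum.inl (w i))), ?_⟩)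
    (fun _ _ => Finset.mem_univ _) ?_ ?_ ?_ ?_
  · have hc' := (Finset.mem_filter.mp hc).2
    rintro (a | i)
    · change c.1 (Sum.inl (glueFun D.pair τ a)) = c.1 (Sum.inl a)
      rcases h : D.pair (Sum.inl a) with b | i
      · rw [glueFun_of_edge D.pair τ a b h, ← h]
        exact c.2 _
      · have h1 : a = w i := by
          have := hw i
          rw [← h, D.isMatching.1] at this
          exact Sum.inl_injective this
        have h2 : ∀ j, c.1 (Sum.inl (w j)) = c.1 (Sum.inr j) := fun j => by
          rw [← hw j]
          exact c.2 _
        rw [h1, hglue, h2, h2, hc']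
    · exact i.elim0
  · rintro (a | i)
    · change _ = c.1 (Sum.inl a)
      rcases h : D.pair (Sum.inl a) with b | i
      · exact (congrArg (fun x => c.1 (Sum.inl x)) (glueFun_of_edge D.pair τ a b h)).symm.trans
          (hcol c a)
      · have h1 : a = w i := by
          have := hw i
          rw [← h, D.isMatching.1] at this
          exact Sum.inl_injective this
        rw [Sum.elim_inr, h1]
    · rw [hw]
      rfl
  · intro c _
    refine Finset.mem_filter.mpr ⟨Finset.mem_univ _, fun i => ?_⟩
    exact (congrArg (fun x => c.1 (Sum.inl x)) (hglue i)).symm.trans (hcol c (w i))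
  · intro c _
    refine Subtype.ext (funext ?_)
    rintro (a | i)
    · rfl
    · change c.1 (Sum.inl (w i)) = _
      rw [← hw i]
      exact c.2 _
  · intro c _
    refine Subtype.ext (funext ?_)
    rintro (a | i)
    · rfl
    · exact i.elim0
  · intro c _
    have : IsEmpty (Fin 0) := inferInstance
    rw [Fintype.prod_empty (fun i : Fin 0 => _), mul_one]
    rfl

/-- The weight of a closure is the Gaussian expectation of the weight with indeterminates at
the legs. -/
theorem sum_weight_join (f : I → I → I → R) (y : I → R) {D : Character u} (hD : NoInterval D) :
    ∑ τ : {τ : Equiv.Perm (Fin u) // IsMatching τ}, weight id f y (D.join τ.1 τ.2) =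
      gaussian (weight id (fun a b c => MvPolynomial.C (f a b c)) MvPolynomial.X D) := by
  simp only [weight_join f y hD]
  rw [Finset.sum_comm, weight, map_sum]
  refine Finset.sum_congr rfl fun c _ => ?_
  have h1 : ∏ v, vertexValue (fun a b c => MvPolynomial.C (σ := I) (f a b c))
      (fun a => c.1 (Sum.inl a)) v =
      MvPolynomial.C (∏ v, vertexValue f (fun a => c.1 (Sum.inl a)) v) := by
    rw [map_prod]
    rfl
  rw [h1, ← MvPolynomial.smul_eq_C_mul, map_smul, gaussian_prod_X, ← Finset.sum_filter,
    Finset.sum_const, smul_eq_mul, nsmul_eq_mul, mul_comm]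
  congr 2
  rw [← Fintype.card_subtype]
  exact Fintype.card_congr (Equiv.subtypeSubtypeEquivSubtypeInter IsMatching
    fun τ : Equiv.Perm (Fin u) => ∀ i, c.1 (Sum.inr (τ i)) = c.1 (Sum.inr i))

theorem weightMap_closeChar [Algebra ℚ R] {f : I → I → I → R} (hf : IsLieTensor id f) (y : I → R)
    (z : ℚ) {D : Character u} (hD : NoInterval D) :
    weightMap hf y 0 (closeChar z D) =
      gaussian (weight id (fun a b c => MvPolynomial.C (f a b c)) MvPolynomial.X D) := by
  rw [closeChar, map_sum, ← sum_weight_join f y hD]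
  refine Finset.sum_congr rfl fun τ _ => ?_
  rw [hD.numCircles_eq_zero, pow_zero, one_smul, weightMap_cls]

end Closure

/-! ### The weight of a wheel -/

section Wheel

variable {I R : Type} [Fintype I] [DecidableEq I] [CommRing R]

omit [DecidableEq I] in
theorem sum_consEquiv {M : Type} [AddCommMonoid M] {n : ℕ} (F : (Fin (n + 1) → I) → M) :
    ∑ w, F w = ∑ a, ∑ z : Fin n → I, F (Fin.cons a z) := by
  rw [← Fintype.sum_prod_type']
  exact (Fintype.sum_equiv (Fin.consEquiv fun _ => I) _ _ fun p => rfl).symm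

/-- A matrix power as a sum over paths. -/
theorem sum_path (N : Matrix I I R) (g : I → R) (n : ℕ) (a : I) :
    ∑ z : Fin n → I, (∏ i : Fin n, N ((Fin.cons a z : Fin (n + 1) → I) i.castSucc) (z i)) *
      g ((Fin.cons a z : Fin (n + 1) → I) (Fin.last n)) = (N ^ n).mulVec g a := by
  induction n generalizing a with
  | zero => simp
  | succ n ih =>
    rw [sum_consEquiv, pow_succ', ← Matrix.mulVec_mulVec, Matrix.mulVec, dotProduct]
    refine Finset.sum_congr rfl fun b _ => ?_
    rw [← ih b, Finset.mul_sum]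
    refine Finset.sum_congr rfl fun z _ => ?_
    rw [Fin.prod_univ_succ, ← mul_assoc, ← Fin.succ_last, Fin.cons_succ]
    congr 1

/-- The trace of a matrix power as a sum over closed paths. -/
theorem sum_closed_path (N : Matrix I I R) (n : ℕ) :
    ∑ w : Fin (n + 1) → I, ∏ i, N (w i) (w (finRotate (n + 1) i)) = (N ^ (n + 1)).trace := by
  rw [sum_consEquiv, Matrix.trace]
  refine Finset.sum_congr rfl fun a _ => ?_
  have h := sum_path N (fun b => N b a) n a
  have h2 : (N ^ n).mulVec (fun b => N b a) a = (N ^ (n + 1)).diag a := by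
    rw [pow_succ, Matrix.diag_apply, Matrix.mul_apply]
    rfl
  rw [← h2, ← h]
  refine Finset.sum_congr rfl fun z _ => ?_
  rw [Fin.prod_univ_castSucc, finRotate_last, Fin.cons_zero]
  congr 1
  refine Finset.prod_congr rfl fun i _ => ?_
  rw [finRotate_apply, Fin.coeSucc_eq_succ, Fin.cons_succ]

/-- The matrix, up to transposition, of the adjoint action of the vector `y`. -/
def adMatrix (f : I → I → I → R) (y : I → R) : Matrix I I R :=
  Matrix.of fun a b => ∑ c, y c * f c b a

/-- A wheel evaluates to the trace of a power of the adjoint action. -/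
theorem weight_wheel (f : I → I → I → R) (y : I → R) (n : ℕ) :
    weight id f y (Character.wheel (n + 1)) = (adMatrix f y ^ (n + 1)).trace := by
  let col : (Fin (n + 1) → I) × (Fin (n + 1) → I) → Flag (n + 1) (n + 1) → I := fun p x =>
    match x with
    | Sum.inl (i, 0) => p.2 i
    | Sum.inl (i, 1) => p.1 i
    | Sum.inl (i, 2) => p.1 ((finRotate (n + 1)).symm i)
    | Sum.inr i => p.2 i
  have hcol : ∀ p, ∀ x, col p ((Character.wheel (n + 1)).pair x) = id (col p x) := by
    rintro p (⟨i, j⟩ | i)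
    · fin_cases j
      · rfl
      · exact congrArg p.1 ((finRotate (n + 1)).symm_apply_apply i)
      · rfl
    · rfl
  let e : (Fin (n + 1) → I) × (Fin (n + 1) → I) ≃
      Coloring (id : I → I) (Character.wheel (n + 1)) :=
    { toFun := fun p => ⟨col p, hcol p⟩
      invFun := fun c => (fun i => c.1 (Sum.inl (i, 1)), fun i => c.1 (Sum.inr i))
      left_inv := fun p => rfl
      right_inv := fun c => by
        refine Subtype.ext (funext ?_)
        rintro (⟨i, j⟩ | i)
        · fin_cases j
          · exact c.2 (Sum.inl (i, 0))
          · rfl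
          · exact c.2 (Sum.inl (i, 2))
        · rfl }
  rw [weight, ← Fintype.sum_equiv e _ _ fun p => rfl, ← sum_closed_path, Fintype.sum_prod_type]
  refine Finset.sum_congr rfl fun z _ => ?_
  have h1 : ∏ i, adMatrix f y (z i) (z (finRotate (n + 1) i)) =
      ∏ i, ∑ c, y c * f c (z i) (z ((finRotate (n + 1)).symm i)) :=
    Fintype.prod_equiv (finRotate (n + 1)) _ _ fun i => by
      rw [Equiv.symm_apply_apply]
      rfl
  rw [h1, Fintype.prod_sum]
  refine Finset.sum_congr rfl fun x _ => ?_
  rw [Finset.prod_mul_distrib, mul_comm]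
  rfl

end Wheel

/-! ### The Lie algebra `so(3)` and its direct sums -/

section SoThree

/-- The structure constants of `so(3)` in an orthonormal basis. -/
def eps (a b c : Fin 3) : ℤ :=
  if b = a + 1 ∧ c = a + 2 then 1 else if b = a + 2 ∧ c = a + 1 then -1 else 0

theorem eps_isLieTensor : IsLieTensor id eps where
  invol _ := rfl
  cyclic := by decide
  antisymm := by decide
  jacobi := by decide +kernel

/-- The unit tensor on `m` points, weighted by indeterminates. -/
noncomputable def copyTensor (m : ℕ) (j k l : Fin m) : MvPolynomial (Fin m) ℚ :=
  if j = k ∧ k = l then MvPolynomial.X j else 0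

/-- The structure constants of the direct sum of `m` copies of `so(3)`, the bracket of the `j`-th
copy being scaled by the indeterminate `X j`. -/
noncomputable def soTensor (m : ℕ) (a b c : Fin 3 × Fin m) : MvPolynomial (Fin m) ℚ :=
  (eps a.1 b.1 c.1 : MvPolynomial (Fin m) ℚ) * copyTensor m a.2 b.2 c.2

theorem copyTensor_mul (m : ℕ) (e a b c d : Fin m) :
    copyTensor m e a b * copyTensor m e c d =
      if e = a ∧ e = b ∧ e = c ∧ e = d then MvPolynomial.X e ^ 2 else 0 := by
  unfold copyTensor
  split_ifs with h1 h2 h3 h3 h3 h3 <;> first | ring1 | (exfalso; grind)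

theorem soTensor_isLieTensor (m : ℕ) : IsLieTensor id (soTensor m) where
  invol _ := rfl
  cyclic a b c := by
    unfold soTensor copyTensor
    rw [eps_isLieTensor.cyclic]
    congr 1
    grind
  antisymm a b c := by
    unfold soTensor copyTensor
    rw [eps_isLieTensor.antisymm a.1]
    push_cast
    rw [neg_mul]
    congr 2
    grind
  jacobi a b c d := by
    rw [Fintype.sum_prod_type, Finset.sum_comm]
    refine Finset.sum_eq_zero fun k _ => ?_
    have h := congrArg (Int.cast : ℤ → MvPolynomial (Fin m) ℚ)
      (eps_isLieTensor.jacobi a.1 b.1 c.1 d.1)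
    push_cast at h
    have h2 := congrArg (· * (if k = a.2 ∧ k = b.2 ∧ k = c.2 ∧ k = d.2 then
      (MvPolynomial.X k : MvPolynomial (Fin m) ℚ) ^ 2 else 0)) h
    simp only [zero_mul, Finset.sum_mul] at h2
    rw [← h2]
    refine Finset.sum_congr rfl fun e _ => ?_
    have e1 := copyTensor_mul m k a.2 b.2 c.2 d.2
    have e2 := copyTensor_mul m k b.2 c.2 a.2 d.2
    have e3 := copyTensor_mul m k c.2 a.2 b.2 d.2
    have g2 : (k = b.2 ∧ k = c.2 ∧ k = a.2 ∧ k = d.2) ↔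
        (k = a.2 ∧ k = b.2 ∧ k = c.2 ∧ k = d.2) := by tauto
    have g3 : (k = c.2 ∧ k = a.2 ∧ k = b.2 ∧ k = d.2) ↔
        (k = a.2 ∧ k = b.2 ∧ k = c.2 ∧ k = d.2) := by tauto
    rw [if_congr g2 rfl rfl] at e2
    rw [if_congr g3 rfl rfl] at e3
    rw [← e1] at e2 e3 ⊢
    simp only [soTensor, id_eq]
    linear_combination
      ((eps e b.1 c.1 : MvPolynomial (Fin m) ℚ) * (eps e a.1 d.1 : MvPolynomial (Fin m) ℚ)) * e2 +
      ((eps e c.1 a.1 : MvPolynomial (Fin m) ℚ) * (eps e b.1 d.1 : MvPolynomial (Fin m) ℚ)) * e3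

/-- The adjoint action `N` of `ξ` in `so(3)` is the cross product with `ξ`; it satisfies
`N ^ 4 = -|ξ|² N ^ 2`. -/
theorem trace_cross_pow {A : Type} [CommRing A] (ξ : Fin 3 → A) (k : ℕ) :
    (adMatrix (fun a b c => (eps a b c : A)) ξ ^ (2 * (k + 1))).trace =
      2 * (-1) ^ (k + 1) * (∑ c, ξ c ^ 2) ^ (k + 1) := by
  set N := adMatrix (fun a b c => (eps a b c : A)) ξ with hN
  have hN' : N = !![0, -ξ 2, ξ 1; ξ 2, 0, -ξ 0; -ξ 1, ξ 0, 0] := by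
    ext a b
    fin_cases a <;> fin_cases b <;> simp [hN, adMatrix, Fin.sum_univ_three, eps]
  have h2 : N ^ 2 = !![-ξ 2 ^ 2 - ξ 1 ^ 2, ξ 0 * ξ 1, ξ 0 * ξ 2;
      ξ 0 * ξ 1, -ξ 2 ^ 2 - ξ 0 ^ 2, ξ 1 * ξ 2; ξ 0 * ξ 2, ξ 1 * ξ 2, -ξ 1 ^ 2 - ξ 0 ^ 2] := by
    rw [pow_two, hN']
    ext a b
    fin_cases a <;> fin_cases b <;> simp [Matrix.mul_apply, Fin.sum_univ_three] <;> ring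
  have h4 : N ^ 2 * N ^ 2 = (-∑ c, ξ c ^ 2) • N ^ 2 := by
    rw [h2]
    ext a b
    fin_cases a <;> fin_cases b <;> simp [Matrix.mul_apply, Fin.sum_univ_three] <;> ring
  have hpow : ∀ k : ℕ, (N ^ 2) ^ (k + 1) = (-∑ c, ξ c ^ 2) ^ k • N ^ 2 := by
    intro k
    induction k with
    | zero => simp
    | succ k ih => rw [pow_succ (N ^ 2), ih, Matrix.smul_mul, h4, smul_smul, ← pow_succ]
  have htr : (N ^ 2).trace = -2 * ∑ c, ξ c ^ 2 := by
    rw [h2]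
    simp [Matrix.trace, Fin.sum_univ_three]
    ring
  rw [pow_mul, hpow, Matrix.trace_smul, htr, smul_eq_mul, neg_pow]
  ring

/-- The squared norm of the generic vector in the `j`-th copy of `so(3)`, scaled by the square of
the scaling factor. -/
noncomputable def normSq (m : ℕ) (j : Fin m) :
    MvPolynomial (Fin 3 × Fin m) (MvPolynomial (Fin m) ℚ) :=
  MvPolynomial.C (MvPolynomial.X j) ^ 2 * ∑ c : Fin 3, MvPolynomial.X (c, j) ^ 2

theorem weight_wheel_soTensor (m k : ℕ) :
    weight id (fun a b c => MvPolynomial.C (soTensor m a b c)) MvPolynomial.X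
      (Character.wheel (2 * (k + 1))) =
    2 * (-1) ^ (k + 1) * ∑ j, normSq m j ^ (k + 1) := by
  have hM : adMatrix (fun a b c => MvPolynomial.C (soTensor m a b c)) MvPolynomial.X =
      Matrix.blockDiagonal fun j : Fin m =>
        (MvPolynomial.C (MvPolynomial.X j) :
          MvPolynomial (Fin 3 × Fin m) (MvPolynomial (Fin m) ℚ)) •
        adMatrix (fun a b c => (eps a b c : MvPolynomial (Fin 3 × Fin m) (MvPolynomial (Fin m) ℚ)))
          (fun c => MvPolynomial.X (c, j)) := by
    ext1 ⟨a, j⟩ ⟨b, k⟩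
    rw [Matrix.blockDiagonal_apply, adMatrix, Matrix.of_apply, Fintype.sum_prod_type,
      Finset.sum_comm]
    simp only [soTensor, copyTensor]
    split_ifs with h
    · have hjk : j = k := h
      subst hjk
      rw [Finset.sum_eq_single j]
      · simp only [and_self, if_true, Matrix.smul_apply, adMatrix, Matrix.of_apply, smul_eq_mul,
          Finset.mul_sum, map_mul, map_intCast]
        refine Finset.sum_congr rfl fun c _ => ?_
        ring
      · intro l _ hl
        simp [hl]
      · simp
    · refine Finset.sum_eq_zero fun l _ => Finset.sum_eq_zero fun c _ => ?_
      rw [if_neg, mul_zero, map_zero, mul_zero]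
      exact fun h' => h h'.2.symm
  rw [show 2 * (k + 1) = (2 * k + 1) + 1 by ring, weight_wheel, hM,
    show (2 * k + 1) + 1 = 2 * (k + 1) by ring, ← Matrix.blockDiagonal_pow,
    Matrix.trace_blockDiagonal, Finset.mul_sum]
  refine Finset.sum_congr rfl fun j _ => ?_
  rw [Pi.pow_apply, smul_pow, Matrix.trace_smul, trace_cross_pow, normSq, smul_eq_mul, mul_pow,
    ← pow_mul]
  ring

end SoThree

/-! ### Independence of the power sums -/

section PowerSums

open MvPolynomial

/-- The chain rule for polynomials. -/
theorem pderiv_aeval {σ τ : Type} [Fintype σ] (g : σ → MvPolynomial τ ℚ) (j : τ)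
    (F : MvPolynomial σ ℚ) :
    pderiv j (aeval g F) = ∑ k, aeval g (pderiv k F) * pderiv j (g k) := by
  classical
  induction F using MvPolynomial.induction_on with
  | C a => simp [algebraMap_eq]
  | add p q hp hq => simp only [map_add, hp, hq, add_mul, Finset.sum_add_distrib]
  | mul_X p i hp =>
    simp only [map_mul, pderiv_mul, hp, aeval_X, map_add, add_mul, Finset.sum_add_distrib,
      pderiv_X]
    congr 1
    · rw [Finset.sum_mul]
      refine Finset.sum_congr rfl fun k _ => ?_
      ring
    · rw [Finset.sum_eq_single i]
      · simp
      · intro k _ hk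
        simp [hk.symm]
      · simp

variable {m : ℕ} (a : Fin m → ℚ)

/-- By the Vandermonde determinant the Jacobian of the power sums is not zero, so that the
relations between them are closed under differentiation. -/
theorem aeval_psum_pderiv_eq_zero (ha : ∀ k, a k ≠ 0) {F : MvPolynomial (Fin m) ℚ}
    (hF : aeval (fun k : Fin m => C (a k) * psum (Fin m) ℚ (k + 1)) F = 0) (k : Fin m) :
    aeval (fun k : Fin m => C (a k) * psum (Fin m) ℚ (k + 1)) (pderiv k F) = 0 := by
  set g : Fin m → MvPolynomial (Fin m) ℚ := fun k => C (a k) * psum (Fin m) ℚ (k + 1) with hg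
  have hp : ∀ j k : Fin m, pderiv j (g k) = C (a k * (k + 1)) * X j ^ (k : ℕ) := by
    intro j k
    simp only [hg, psum, pderiv_C_mul, map_sum, pderiv_pow, pderiv_X]
    rw [Finset.sum_eq_single j]
    · simp
      ring
    · intro l _ hl
      simp [hl]
    · simp
  have key : ∀ j : Fin m, ∑ k : Fin m,
      (X j : MvPolynomial (Fin m) ℚ) ^ (k : ℕ) *
        (C (a k * (k + 1)) * aeval g (pderiv k F)) = 0 := by
    intro j
    have h := pderiv_aeval g j F
    rw [hF, map_zero] at h
    rw [h]
    refine Finset.sum_congr rfl fun k _ => ?_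
    rw [hp]
    ring
  have h0 := Matrix.eq_zero_of_forall_index_sum_pow_mul_eq_zero
    (v := fun k : Fin m => C (a k * (k + 1)) * aeval g (pderiv k F))
    (X_injective (σ := Fin m) (R := ℚ)) key
  have hk := congrFun h0 k
  rcases mul_eq_zero.mp hk with h | h
  · rw [C_eq_zero] at h
    exact absurd h (mul_ne_zero (ha k) (by positivity))
  · exact h

/-- Nonzero multiples of the first `m` power sums in `m` variables satisfy no algebraic relation. -/
theorem eq_zero_of_aeval_psum_eq_zero (ha : ∀ k, a k ≠ 0) {F : MvPolynomial (Fin m) ℚ}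
    (hF : aeval (fun k : Fin m => C (a k) * psum (Fin m) ℚ (k + 1)) F = 0) : F = 0 := by
  have key : ∀ n : ℕ, ∀ F : MvPolynomial (Fin m) ℚ,
      aeval (fun k : Fin m => C (a k) * psum (Fin m) ℚ (k + 1)) F = 0 →
      ∀ α : Fin m →₀ ℕ, α.degree = n → coeff α F = 0 := by
    intro n
    induction n with
    | zero =>
      intro F hF α hα
      rw [Finsupp.degree_eq_zero_iff] at hα
      subst hα
      have h := congrArg constantCoeff hF
      have h2 : (constantCoeff : MvPolynomial (Fin m) ℚ →+* ℚ).comp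
          (aeval (fun k : Fin m => C (a k) * psum (Fin m) ℚ (k + 1)) :
            MvPolynomial (Fin m) ℚ →ₐ[ℚ] MvPolynomial (Fin m) ℚ).toRingHom = constantCoeff := by
        refine MvPolynomial.ringHom_ext (fun r => ?_) fun k => ?_
        · simp
        · simp [psum]
      have h3 := congrArg (fun φ : MvPolynomial (Fin m) ℚ →+* ℚ => φ F) h2
      rw [← constantCoeff_eq, ← h3]
      simpa using h
    | succ n ih =>
      intro F hF α hα
      obtain ⟨i, hi⟩ : ∃ i, α i ≠ 0 := by
        by_contra! h
        have : α = 0 := Finsupp.ext h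
        rw [this] at hα
        simp at hα
      obtain ⟨β, rfl⟩ : ∃ β, α = β + Finsupp.single i 1 :=
        ⟨α - Finsupp.single i 1, (tsub_add_cancel_of_le (by
          rw [Finsupp.single_le_iff]; omega)).symm⟩
      have h := ih _ (aeval_psum_pderiv_eq_zero a ha hF i) β (by
        simpa [map_add, Finsupp.degree_single] using hα)
      rw [coeff_pderiv] at h
      rcases mul_eq_zero.mp h with h | h
      · exact h
      · exact absurd h (by positivity)
  ext α
  exact key _ F hF α rfl

/-- The Gaussian functional, applied to polynomials in the scaled squared norms, loses no
information. -/
theorem eq_zero_of_gaussian_aeval_normSq {G : MvPolynomial (Fin m) ℚ}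
    (hG : gaussian (aeval (normSq m) G) = 0) : G = 0 := by
  let Q : (Fin m →₀ ℕ) → MvPolynomial (Fin 3 × Fin m) ℕ := fun μ =>
    ∏ j, (∑ c : Fin 3, X (c, j)) ^ μ j
  have hQ : ∀ μ, Q μ ≠ 0 := by
    intro μ h
    have := congrArg (eval fun _ => 1) h
    simp [Q, Finset.prod_eq_zero_iff] at this
  have hmon : ∀ μ r, gaussian (aeval (normSq m) (monomial μ r)) =
      monomial (2 • μ) (r * ((gaussian (expand 2 (Q μ)) : ℕ) : ℚ)) := by
    intro μ r
    have h1 : aeval (normSq m) (monomial μ r) =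
        (C (monomial (2 • μ) r) : MvPolynomial (Fin 3 × Fin m) (MvPolynomial (Fin m) ℚ)) *
          map (Nat.castRingHom _) (expand 2 (Q μ)) := by
      rw [aeval_monomial, monomial_eq, Finsupp.prod_fintype _ _ (fun _ => pow_zero _),
        Finsupp.prod_fintype _ _ (fun _ => pow_zero _)]
      simp only [normSq, mul_pow, Finset.prod_mul_distrib, Q, map_prod, map_pow, map_sum, map_mul,
        expand_X, map_X, ← pow_mul]
      rw [← mul_assoc]
      rfl
    rw [h1, ← smul_eq_C_mul, map_smul, gaussian_map, smul_eq_mul]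
    change _ * ((gaussian (expand 2 (Q μ)) : ℕ) : MvPolynomial (Fin m) ℚ) = _
    rw [← map_natCast (C : ℚ →+* MvPolynomial (Fin m) ℚ), mul_comm, C_mul_monomial, mul_comm]
  -- distinct monomials `μ` have distinct images `2 • μ`, so the coefficients can be compared
  ext ν
  have h1 : gaussian (aeval (normSq m) G) = ∑ μ ∈ G.support,
      monomial (2 • μ) (coeff μ G * ((gaussian (expand 2 (Q μ)) : ℕ) : ℚ)) := by
    conv_lhs => rw [G.as_sum]
    rw [map_sum, map_sum]
    exact Finset.sum_congr rfl fun μ _ => hmon _ _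
  have h2 := congrArg (coeff (2 • ν)) (h1.symm.trans hG)
  rw [coeff_sum, Finset.sum_eq_single ν] at h2
  · rw [coeff_monomial, if_pos rfl, coeff_zero] at h2
    rcases mul_eq_zero.mp h2 with h | h
    · simpa using h
    · exact absurd (Nat.cast_eq_zero.mp h) (gaussian_expand_ne_zero (hQ ν))
  · intro μ _ hμ
    rw [coeff_monomial, if_neg]
    intro h
    apply hμ
    ext j
    have := DFunLike.congr_fun h j
    simpa using this
  · intro hν
    rw [notMem_support_iff.mp hν]
    simp

/-- The weights of closures of unions of wheels, for all sums of copies of `so(3)`, separate the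
polynomials in the wheels with an even number of legs. -/
theorem eq_zero_of_gaussian_aeval_wheels {F : MvPolynomial ℕ ℚ}
    (hF : ∀ m, gaussian (aeval (fun k => 2 * (-1) ^ (k + 1) * ∑ j, normSq m j ^ (k + 1)) F) = 0) :
    F = 0 := by
  obtain ⟨m, hm⟩ : ∃ m, ∀ k ∈ F.vars, k < m :=
    ⟨F.vars.sup id + 1, fun k hk => Nat.lt_succ_of_le (Finset.le_sup (f := id) hk)⟩
  obtain ⟨G, rfl⟩ := exists_rename_eq_of_vars_subset_range F (Fin.val : Fin m → ℕ)
    Fin.val_injective (fun k hk => ⟨⟨k, hm k hk⟩, rfl⟩)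
  have h := hF m
  rw [aeval_rename] at h
  let a : Fin m → ℚ := fun k => 2 * (-1) ^ ((k : ℕ) + 1)
  have h2 : aeval ((fun k => 2 * (-1) ^ (k + 1) * ∑ j, normSq m j ^ (k + 1)) ∘ Fin.val) G =
      aeval (normSq m) (aeval (fun k : Fin m => C (a k) * psum (Fin m) ℚ (k + 1)) G) := by
    rw [← AlgHom.comp_apply, comp_aeval]
    congr 2
    funext k
    simp only [a, psum, Function.comp_apply, map_mul, map_sum, map_pow, aeval_X, map_neg,
      map_one, map_ofNat]
  rw [h2] at h
  rw [eq_zero_of_aeval_psum_eq_zero a (fun k => by simp [a]) (eq_zero_of_gaussian_aeval_normSq h),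
    map_zero]

end PowerSums

/-! ### Isomorphisms that change orientations -/

section TwistedIso

variable {u u' u'' w w' : ℕ}

/-- The flag bijection given by bijections `f` of the vertices and `g` of the legs, and by
permutations `π v` of the three flags at each vertex `v`. -/
def flagEquiv {t t' : ℕ} (f : Fin t ≃ Fin t') (π : Fin t → Equiv.Perm (Fin 3))
    (g : Fin u ≃ Fin u') : Flag t u ≃ Flag t' u' :=
  Equiv.sumCongr (Equiv.prodShear f π) g

/-- The graphs underlying `D` and `E` are isomorphic; the isomorphism may change the cyclic orders,
and `ε` is its total sign. The numbers of legs need not be equal definitionally. -/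
def TwistedIso (D : Character u) (E : Character u') (ε : ℚ) : Prop :=
  ∃ (f : Fin D.t ≃ Fin E.t) (π : Fin D.t → Equiv.Perm (Fin 3)) (g : Fin u ≃ Fin u'),
    (∀ x, E.pair (flagEquiv f π g x) = flagEquiv f π g (D.pair x)) ∧
    ε = ∏ v, ((Equiv.Perm.sign (π v) : ℤ) : ℚ)

theorem TwistedIso.refl (D : Character u) : TwistedIso D D 1 :=
  ⟨Equiv.refl _, fun _ => 1, Equiv.refl _, fun x => by
    have h : ∀ y, flagEquiv (Equiv.refl (Fin D.t)) (fun _ => 1) (Equiv.refl (Fin u)) y = y := by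
      rintro (⟨v, i⟩ | k) <;> rfl
    rw [h, h], by simp⟩

theorem TwistedIso.trans {D : Character u} {E : Character u'} {F : Character u''} {ε δ : ℚ}
    (h : TwistedIso D E ε) (h' : TwistedIso E F δ) : TwistedIso D F (ε * δ) := by
  obtain ⟨f, π, g, h, rfl⟩ := h
  obtain ⟨f', π', g', h', rfl⟩ := h'
  refine ⟨f.trans f', fun v => π' (f v) * π v, g.trans g', ?_, ?_⟩
  · have key : ∀ x, flagEquiv (f.trans f') (fun v => π' (f v) * π v) (g.trans g') x =
        flagEquiv f' π' g' (flagEquiv f π g x) := by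
      rintro (⟨v, i⟩ | k) <;> rfl
    intro x
    rw [key, key, h', h]
  · rw [← Equiv.prod_comp f fun v => ((Equiv.Perm.sign (π' v) : ℤ) : ℚ),
      ← Finset.prod_mul_distrib]
    refine Finset.prod_congr rfl fun v _ => ?_
    rw [map_mul]
    push_cast
    ring

theorem TwistedIso.of_iso {D E : Character u} (h : D.Iso E) : TwistedIso D E 1 := by
  obtain ⟨f, r, g, h⟩ := h
  refine ⟨f, fun v => Equiv.addRight (r v), g, h, ?_⟩
  have : ∀ i : Fin 3, Equiv.Perm.sign (Equiv.addRight i) = 1 := by decide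
  simp [this]

theorem TwistedIso.disjointUnion {D : Character u} {D' : Character u'} {E : Character w}
    {E' : Character w'} {ε δ : ℚ} (h : TwistedIso D D' ε) (h' : TwistedIso E E' δ) :
    TwistedIso (D.disjointUnion E) (D'.disjointUnion E') (ε * δ) := by
  obtain ⟨f, π, g, h, rfl⟩ := h
  obtain ⟨f', π', g', h', rfl⟩ := h'
  refine ⟨finSumFinEquiv.symm.trans ((Equiv.sumCongr f f').trans finSumFinEquiv),
    fun v => Sum.elim π π' (finSumFinEquiv.symm v),
    finSumFinEquiv.symm.trans ((Equiv.sumCongr g g').trans finSumFinEquiv), ?_, ?_⟩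
  · have key : ∀ z, flagEquiv
        (finSumFinEquiv.symm.trans ((Equiv.sumCongr f f').trans finSumFinEquiv))
        (fun v => Sum.elim π π' (finSumFinEquiv.symm v))
        (finSumFinEquiv.symm.trans ((Equiv.sumCongr g g').trans finSumFinEquiv))
        (Character.flagSum D.t E.t u w z) = Character.flagSum D'.t E'.t u' w'
          (Equiv.sumCongr (flagEquiv f π g) (flagEquiv f' π' g') z) := by
      rintro ((⟨v, i⟩ | k) | (⟨v, i⟩ | k))
      · simp [flagSum_inl_inl, flagEquiv]
      · simp [flagSum_inl_inr, flagEquiv]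
      · simp [flagSum_inr_inl, flagEquiv]
      · simp [flagSum_inr_inr, flagEquiv]
    intro x
    obtain ⟨z, rfl⟩ := (Character.flagSum D.t E.t u w).surjective x
    refine (congrArg _ (key z)).trans ((disjointUnion_pair D' E' _).trans ?_)
    refine Eq.trans ?_ (congrArg _ (disjointUnion_pair D E z)).symm
    refine Eq.trans ?_ (key _).symm
    congr 1
    rcases z with z | z
    · exact congrArg Sum.inl (h z)
    · exact congrArg Sum.inr (h' z)
  · change _ = ∏ v : Fin (D.t + E.t), _
    rw [Fin.prod_univ_add]
    simp

theorem TwistedIso.disjointUnion_left_comm (D : Character u) (E : Character u')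
    (F : Character u'') :
    TwistedIso (D.disjointUnion (E.disjointUnion F)) (E.disjointUnion (D.disjointUnion F)) 1 := by
  let σ : ∀ a b c : ℕ, Fin (a + (b + c)) ≃ Fin (b + (a + c)) := fun a b c =>
    finCongr (by omega : a + (b + c) = a + b + c) |>.trans <|
      finSumFinEquiv.symm.trans <| (Equiv.sumCongr finAddFlip (Equiv.refl (Fin c))).trans <|
      finSumFinEquiv.trans <| finCongr (by omega)
  have s1 : ∀ a b c (i : Fin a), σ a b c (Fin.castAdd (b + c) i) =
      Fin.natAdd b (Fin.castAdd c i) := by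
    intro a b c i
    have : Fin.cast (by omega : a + (b + c) = a + b + c) (Fin.castAdd (b + c) i) =
      Fin.castAdd c (Fin.castAdd b i) := rfl
    simp only [σ, Equiv.trans_apply, finCongr_apply, this, finSumFinEquiv_symm_apply_castAdd]
    simp
    rfl
  have s2 : ∀ a b c (i : Fin b), σ a b c (Fin.natAdd a (Fin.castAdd c i)) =
      Fin.castAdd (a + c) i := by
    intro a b c i
    have : Fin.cast (by omega : a + (b + c) = a + b + c) (Fin.natAdd a (Fin.castAdd c i)) =
      Fin.castAdd c (Fin.natAdd a i) := rfl
    simp only [σ, Equiv.trans_apply, finCongr_apply, this, finSumFinEquiv_symm_apply_castAdd]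
    simp
    rfl
  have s3 : ∀ a b c (i : Fin c), σ a b c (Fin.natAdd a (Fin.natAdd b i)) =
      Fin.natAdd b (Fin.natAdd a i) := by
    intro a b c i
    have : Fin.cast (by omega : a + (b + c) = a + b + c) (Fin.natAdd a (Fin.natAdd b i)) =
      Fin.natAdd (a + b) i := by
      ext
      simp [add_assoc]
    simp only [σ, Equiv.trans_apply, finCongr_apply, this, finSumFinEquiv_symm_apply_natAdd]
    ext
    simp
    omega
  refine ⟨σ D.t E.t F.t, fun _ => 1, σ u u' u'', ?_, by simp⟩
  set φ := flagEquiv (σ D.t E.t F.t) (fun _ => 1) (σ u u' u'') with hφ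
  have k1 : ∀ x : Flag D.t u, φ (Character.flagSum D.t (E.t + F.t) u (u' + u'') (Sum.inl x)) =
      Character.flagSum E.t (D.t + F.t) u' (u + u'')
        (Sum.inr (Character.flagSum D.t F.t u u'' (Sum.inl x))) := by
    rintro (⟨v, i⟩ | k)
    · simp [φ, flagEquiv, flagSum_inl_inl, flagSum_inr_inl, s1]
    · simp [φ, flagEquiv, flagSum_inl_inr, flagSum_inr_inr, s1]
  have k2 : ∀ x : Flag E.t u', φ (Character.flagSum D.t (E.t + F.t) u (u' + u'')
        (Sum.inr (Character.flagSum E.t F.t u' u'' (Sum.inl x)))) =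
      Character.flagSum E.t (D.t + F.t) u' (u + u'') (Sum.inl x) := by
    rintro (⟨v, i⟩ | k)
    · simp [φ, flagEquiv, flagSum_inl_inl, flagSum_inr_inl, s2]
    · simp [φ, flagEquiv, flagSum_inl_inr, flagSum_inr_inr, s2]
  have k3 : ∀ x : Flag F.t u'', φ (Character.flagSum D.t (E.t + F.t) u (u' + u'')
        (Sum.inr (Character.flagSum E.t F.t u' u'' (Sum.inr x)))) =
      Character.flagSum E.t (D.t + F.t) u' (u + u'')
        (Sum.inr (Character.flagSum D.t F.t u u'' (Sum.inr x))) := by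
    rintro (⟨v, i⟩ | k)
    · simp [φ, flagEquiv, flagSum_inr_inl, s3]
    · simp [φ, flagEquiv, flagSum_inr_inr, s3]
  have p1 := disjointUnion_pair D (E.disjointUnion F)
  have p2 := disjointUnion_pair E F
  have p3 := disjointUnion_pair E (D.disjointUnion F)
  have p4 := disjointUnion_pair D F
  intro x
  obtain ⟨z, rfl⟩ := (Character.flagSum D.t (E.t + F.t) u (u' + u'')).surjective x
  rcases z with x | y
  · refine (congrArg _ (k1 x)).trans ?_
    refine (p3 (Sum.inr _)).trans ?_
    refine (congrArg (fun z => Character.flagSum E.t (D.t + F.t) u' (u + u'') (Sum.inr z))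
      (p4 (Sum.inl x))).trans ?_
    exact (k1 _).symm.trans (congrArg φ (p1 (Sum.inl x)).symm)
  · obtain ⟨z, rfl⟩ := (Character.flagSum E.t F.t u' u'').surjective y
    rcases z with x | x
    · refine (congrArg _ (k2 x)).trans ?_
      refine (p3 (Sum.inl x)).trans ?_
      refine (k2 _).symm.trans (congrArg φ ?_)
      refine Eq.trans ?_ (p1 (Sum.inr _)).symm
      exact congrArg (fun z => Character.flagSum D.t (E.t + F.t) u (u' + u'') (Sum.inr z))
        (p2 (Sum.inl x)).symm
    · refine (congrArg _ (k3 x)).trans ?_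
      refine (p3 (Sum.inr _)).trans ?_
      refine (congrArg (fun z => Character.flagSum E.t (D.t + F.t) u' (u + u'') (Sum.inr z))
        (p4 (Sum.inr x))).trans ?_
      refine (k3 _).symm.trans (congrArg φ ?_)
      refine Eq.trans ?_ (p1 (Sum.inr _)).symm
      exact congrArg (fun z => Character.flagSum D.t (E.t + F.t) u (u' + u'') (Sum.inr z))
        (p2 (Sum.inr x)).symm

theorem mk_congr {t : ℕ} {σ σ' : Equiv.Perm (Flag t u)} (h : IsMatching σ) (h' : IsMatching σ')
    (hσ : σ = σ') : Character.mk t σ h = Character.mk t σ' h' := by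
  subst hσ
  rfl

theorem reattach_mul (D : Character u) (p q : Equiv.Perm (Fin D.t × Fin 3)) :
    D.reattach (p * q) = (D.reattach q).reattach p := by
  have key : (D.reattach (p * q)).pair = ((D.reattach q).reattach p).pair := by
    refine Equiv.ext fun x => ?_
    obtain ⟨y, rfl⟩ := (Equiv.sumCongr (p * q) (Equiv.refl (Fin u))).surjective x
    refine (reattach_pair D (p * q) y).trans ?_
    have h : ∀ y : Flag D.t u, Equiv.sumCongr (p * q) (Equiv.refl (Fin u)) y =
        Equiv.sumCongr p (Equiv.refl (Fin u)) (Equiv.sumCongr q (Equiv.refl (Fin u)) y) := by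
      rintro (a | i) <;> rfl
    rw [h, h]
    refine Eq.symm ((reattach_pair (D.reattach q) p _).trans ?_)
    exact congrArg _ (reattach_pair D q y)
  exact mk_congr _ _ key

theorem reattach_one (D : Character u) : D.reattach 1 = D := by
  have key : (D.reattach 1).pair = D.pair := by
    refine Equiv.ext fun x => ?_
    have h : ∀ y : Flag D.t u, Equiv.sumCongr (1 : Equiv.Perm (Fin D.t × Fin 3))
        (Equiv.refl (Fin u)) y = y := by
      rintro (a | i) <;> rfl
    exact (congrArg _ (h x)).symm.trans ((reattach_pair D 1 x).trans (h _))
  exact mk_congr _ _ key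

/-- Permuting the flags at one vertex multiplies the class by the sign of the permutation. -/
theorem cls_reattach_prodExtendRight (t : ℕ) (v : Fin t) (σ : Equiv.Perm (Fin 3)) :
    ∀ (p : Equiv.Perm (Flag t u)) (h : IsMatching p),
      cls ((Character.mk t p h).reattach (Equiv.Perm.prodExtendRight v σ)) =
        ((Equiv.Perm.sign σ : ℤ) : ℚ) • cls (Character.mk t p h) := by
  induction σ using Equiv.Perm.swap_induction_on with
  | one =>
    intro p h
    have h1 : Equiv.Perm.prodExtendRight v (1 : Equiv.Perm (Fin 3)) = 1 := by
      ext1 ⟨w, i⟩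
      by_cases hw : w = v
      · subst hw; simp
      · simp [Equiv.Perm.prodExtendRight_apply_ne, hw]
    rw [h1]
    erw [reattach_one]
    simp
  | swap_mul σ i j hij ih =>
    intro p h
    have h1 : Equiv.Perm.prodExtendRight v (Equiv.swap i j * σ) =
        Equiv.swap (v, i) (v, j) * Equiv.Perm.prodExtendRight v σ := by
      ext1 ⟨w, k⟩
      by_cases hw : w = v
      · subst hw
        simp only [Equiv.Perm.prodExtendRight_apply_eq, Equiv.Perm.mul_apply]
        simp only [Equiv.swap_apply_def, Prod.mk.injEq, true_and]
        split_ifs <;> rfl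
      · simp [Equiv.Perm.prodExtendRight_apply_ne, hw, Equiv.swap_apply_of_ne_of_ne]
    rw [h1]
    erw [reattach_mul]
    let D := (Character.mk t p h).reattach (Equiv.Perm.prodExtendRight v σ)
    have h2 : cls (D.reattach (Equiv.swap (v, i) (v, j))) + cls D = 0 :=
      (Submodule.Quotient.mk_eq_zero _).mpr
        (Submodule.subset_span (Relator.antisymmetry D v i j hij))
    have h3 : cls D = _ := ih p h
    refine (eq_neg_of_add_eq_zero_left h2).trans ?_
    rw [h3, Equiv.Perm.sign_mul, Equiv.Perm.sign_swap hij]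
    simp

/-- Permuting the flags at each vertex multiplies the class by the product of the signs. -/
theorem cls_reattach_prodShear (t : ℕ) (π : Fin t → Equiv.Perm (Fin 3)) (p : Equiv.Perm (Flag t u))
    (h : IsMatching p) :
    cls ((Character.mk t p h).reattach (Equiv.prodShear (Equiv.refl _) π)) =
      (∏ v, ((Equiv.Perm.sign (π v) : ℤ) : ℚ)) • cls (Character.mk t p h) := by
  have key : ∀ s : Finset (Fin t),
      cls ((Character.mk t p h).reattach
        (Equiv.prodShear (Equiv.refl _) fun v => if v ∈ s then π v else 1)) =
      (∏ v ∈ s, ((Equiv.Perm.sign (π v) : ℤ) : ℚ)) • cls (Character.mk t p h) := by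
    intro s
    induction s using Finset.induction_on with
    | empty =>
      have h1 : Equiv.prodShear (Equiv.refl (Fin t))
          (fun v => if v ∈ (∅ : Finset (Fin t)) then π v else 1) = 1 := by
        ext1 ⟨w, i⟩
        simp [Equiv.prodShear]
      rw [h1]
      erw [reattach_one]
      simp
    | insert v s hv ih =>
      have h1 : Equiv.prodShear (Equiv.refl (Fin t))
          (fun w => if w ∈ insert v s then π w else 1) =
          Equiv.Perm.prodExtendRight v (π v) * Equiv.prodShear (Equiv.refl (Fin t))
            (fun w => if w ∈ s then π w else 1) := by
        ext1 ⟨w, i⟩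
        by_cases hw : w = v
        · subst hw
          simp [Equiv.prodShear, hv]
        · simp [Equiv.prodShear, hw, Equiv.Perm.prodExtendRight_apply_ne]
      rw [h1]
      erw [reattach_mul]
      rw [Finset.prod_insert hv, mul_smul, ← ih]
      exact cls_reattach_prodExtendRight t v (π v) _ _
  simpa using key Finset.univ

/-- By antisymmetry, graphs that are isomorphic up to the cyclic orders have equal classes up to the
total sign. -/
theorem TwistedIso.clsB_eq {D : Character u} {E : Character u'} {ε : ℚ} (h : TwistedIso D E ε) :
    clsB E = ε • clsB D := by
  obtain ⟨f, π, g, h, rfl⟩ := h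
  obtain rfl : u = u' := by simpa using Fintype.card_congr g
  have hiso : (D.reattach (Equiv.prodShear (Equiv.refl _) π)).Iso E := by
    refine ⟨f, fun _ => 0, g, fun x => ?_⟩
    obtain ⟨y, rfl⟩ := (Equiv.sumCongr (Equiv.prodShear (Equiv.refl (Fin D.t)) π)
      (Equiv.refl (Fin u))).surjective x
    have key : ∀ y : Flag D.t u, Equiv.sumCongr (Character.vertexEquiv f fun _ => 0) g
        (Equiv.sumCongr (Equiv.prodShear (Equiv.refl (Fin D.t)) π) (Equiv.refl (Fin u)) y) =
        flagEquiv f π g y := by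
      rintro (⟨v, i⟩ | k)
      · simp [Character.vertexEquiv, flagEquiv, Equiv.prodShear]
      · rfl
    refine (congrArg _ (key y)).trans ((h y).trans ?_)
    exact (key _).symm.trans (congrArg _ (reattach_pair D _ y).symm)
  rw [clsB, clsB, ← map_smul, ← cls_eq_of_iso hiso]
  congr 1
  exact cls_reattach_prodShear D.t π D.pair D.isMatching

end TwistedIso

/-! ### Disjoint unions of wheels -/

section Wheels

variable {u u' : ℕ}

/-- The disjoint union of the wheels with the given numbers of legs. -/
def wheels : List ℕ → Σ u : ℕ, Character u
  | [] => ⟨0, Character.empty⟩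
  | k :: l => ⟨_, (Character.wheel k).disjointUnion (wheels l).2⟩

theorem wheels_perm {l l' : List ℕ} (h : l.Perm l') : TwistedIso (wheels l).2 (wheels l').2 1 := by
  induction h with
  | nil => exact TwistedIso.refl _
  | cons k _ ih =>
    have := (TwistedIso.refl (Character.wheel k)).disjointUnion ih
    rwa [one_mul] at this
  | swap k k' l => exact TwistedIso.disjointUnion_left_comm _ _ _
  | trans _ _ ih ih' => simpa using ih.trans ih'

theorem Character.IsWheels.exists_wheels {D : Character u} (h : D.IsWheels) :
    ∃ l : List ℕ, (∀ k ∈ l, 1 ≤ k) ∧ TwistedIso (wheels l).2 D 1 := by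
  induction h with
  | empty => exact ⟨[], by simp, TwistedIso.refl _⟩
  | union k u D hk _ ih =>
    obtain ⟨l, hl, h⟩ := ih
    refine ⟨k :: l, by simpa using ⟨hk, hl⟩, ?_⟩
    have := (TwistedIso.refl (Character.wheel k)).disjointUnion h
    rwa [one_mul] at this
  | iso u D E _ hDE ih =>
    obtain ⟨l, hl, h⟩ := ih
    exact ⟨l, hl, by simpa using h.trans (TwistedIso.of_iso hDE)⟩

/-- The reflection of a wheel reverses the orientation of every vertex. -/
theorem twistedIso_wheel (n : ℕ) :
    TwistedIso (Character.wheel (n + 1)) (Character.wheel (n + 1)) ((-1) ^ (n + 1)) := by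
  refine ⟨Equiv.neg (Fin (n + 1)), fun _ => Equiv.swap 1 2, Equiv.neg (Fin (n + 1)), ?_, ?_⟩
  · have h1 : ∀ i : Fin (n + 1), (finRotate (n + 1)).symm (-i) = -(finRotate (n + 1) i) := by
      intro i
      rw [Equiv.symm_apply_eq, finRotate_apply, finRotate_apply]
      abel
    have h2 : ∀ i : Fin (n + 1), finRotate (n + 1) (-i) = -((finRotate (n + 1)).symm i) := by
      intro i
      obtain ⟨j, rfl⟩ := (finRotate (n + 1)).surjective i
      rw [Equiv.symm_apply_apply, ← h1, Equiv.apply_symm_apply]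
    rintro (⟨i, j⟩ | i)
    · fin_cases j
      · rfl
      · exact congrArg (fun a => Sum.inl (a, (1 : Fin 3))) (h1 i)
      · exact congrArg (fun a => Sum.inl (a, (2 : Fin 3))) (h2 i)
    · rfl
  · rw [Finset.prod_congr rfl fun _ _ => by rw [Equiv.Perm.sign_swap (by decide)]]
    change _ = ∏ _v : Fin (n + 1), (((-1 : ℤˣ) : ℤ) : ℚ)
    simp

/-- Reflecting a wheel with an odd number of legs changes the sign of the class, which therefore
vanishes. -/
theorem clsB_wheels_eq_zero {l : List ℕ} {k : ℕ} (hk : Odd k) (hkl : k ∈ l) :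
    clsB (wheels l).2 = 0 := by
  obtain ⟨n, rfl⟩ : ∃ n, k = n + 1 := ⟨k - 1, (Nat.sub_add_cancel hk.pos).symm⟩
  have h1 := (wheels_perm (List.perm_cons_erase hkl)).clsB_eq
  rw [one_smul] at h1
  have h2 : clsB (wheels ((n + 1) :: l.erase (n + 1))).2 =
      ((-1) ^ (n + 1) * 1 : ℚ) • clsB (wheels ((n + 1) :: l.erase (n + 1))).2 :=
    ((twistedIso_wheel n).disjointUnion (TwistedIso.refl (wheels (l.erase (n + 1))).2)).clsB_eq
  rw [hk.neg_one_pow, mul_one, h1, ← sub_eq_zero] at h2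
  have h3 : (2 : ℚ) • clsB (wheels l).2 = 0 := by
    rw [← h2]
    module
  exact (smul_eq_zero.mp h3).resolve_left two_ne_zero

/-- The list of the numbers of legs of the wheels in a monomial; the `k`-th variable stands for the
wheel with `2 (k + 1)` legs. -/
noncomputable def legNumbers (μ : ℕ →₀ ℕ) : List ℕ :=
  (μ.toMultiset.toList).map fun k => 2 * (k + 1)

/-- The linear map from polynomials to `𝓑` that takes monomials to the corresponding disjoint
unions of wheels with even numbers of legs. -/
noncomputable def wheelMap : MvPolynomial ℕ ℚ →ₗ[ℚ] B :=
  (MvPolynomial.basisMonomials ℕ ℚ).constr ℚ fun μ => clsB (wheels (legNumbers μ)).2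

theorem wheelMap_monomial (μ : ℕ →₀ ℕ) (r : ℚ) :
    wheelMap (MvPolynomial.monomial μ r) = r • clsB (wheels (legNumbers μ)).2 := by
  have h := (MvPolynomial.basisMonomials ℕ ℚ).constr_basis ℚ
    (fun μ => clsB (wheels (legNumbers μ)).2) μ
  rw [MvPolynomial.coe_basisMonomials] at h
  have h2 : MvPolynomial.monomial μ r = r • MvPolynomial.monomial μ (1 : ℚ) := by
    rw [MvPolynomial.smul_monomial, smul_eq_mul, mul_one]
  rw [h2, map_smul]
  exact congrArg (r • ·) h

/-- Unions of wheels with even numbers of legs span `𝓑_wh`, since a union containing a wheel with an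
odd number of legs has class zero. -/
theorem BWheels_le_range : BWheels ≤ LinearMap.range wheelMap := by
  refine Submodule.span_le.mpr ?_
  rintro x ⟨u, D, hD, rfl⟩
  obtain ⟨l, hl, h⟩ := hD.exists_wheels
  rw [h.clsB_eq, one_smul]
  by_cases hodd : ∃ k ∈ l, Odd k
  · obtain ⟨k, hkl, hk⟩ := hodd
    rw [clsB_wheels_eq_zero hk hkl]
    exact zero_mem _
  · -- on positive even numbers `k ↦ k / 2 - 1` inverts `k ↦ 2 * (k + 1)`
    refine ⟨MvPolynomial.monomial (Multiset.toFinsupp ((l.map fun k => k / 2 - 1 : List ℕ) :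
      Multiset ℕ)) 1, ?_⟩
    rw [wheelMap_monomial, one_smul]
    have hperm : (legNumbers (Multiset.toFinsupp ((l.map fun k => k / 2 - 1 : List ℕ) :
        Multiset ℕ))).Perm l := by
      rw [legNumbers, Multiset.toFinsupp_toMultiset, ← Multiset.coe_eq_coe, ← Multiset.map_coe,
        Multiset.coe_toList, Multiset.map_coe, List.map_map, List.map_congr_left (g := id),
        List.map_id]
      intro k hk
      have h1 := hl k hk
      have h2 : ¬ Odd k := fun h => hodd ⟨k, hk, h⟩
      rw [Nat.not_odd_iff_even] at h2
      obtain ⟨j, rfl⟩ := h2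
      simp only [Function.comp_apply, id_eq]
      omega
    have := (wheels_perm hperm).clsB_eq
    rw [one_smul] at this
    exact this.symm

theorem NoInterval.disjointUnion {D : Character u} {E : Character u'} (hD : NoInterval D)
    (hE : NoInterval E) : NoInterval (D.disjointUnion E) := by
  intro i
  obtain ⟨j | j, rfl⟩ := finSumFinEquiv.surjective i
  · obtain ⟨a, ha⟩ := hD j
    refine ⟨(Fin.castAdd E.t a.1, a.2), ?_⟩
    have := disjointUnion_pair D E (Sum.inl (Sum.inr j))
    rw [Equiv.sumCongr_apply, Sum.map_inl, ha] at this
    exact this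
  · obtain ⟨a, ha⟩ := hE j
    refine ⟨(Fin.natAdd D.t a.1, a.2), ?_⟩
    have := disjointUnion_pair D E (Sum.inr (Sum.inr j))
    rw [Equiv.sumCongr_apply, Sum.map_inr, ha] at this
    exact this

theorem noInterval_wheels (l : List ℕ) : NoInterval (wheels l).2 := by
  induction l with
  | nil => exact fun i => i.elim0
  | cons k l ih =>
    have h : NoInterval (Character.wheel k) := fun i => ⟨(i, 0), rfl⟩
    exact NoInterval.disjointUnion h ih

theorem weight_wheels {I R : Type} [Fintype I] [DecidableEq I] [CommRing R] (s : I → I)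
    (f : I → I → I → R) (y : I → R) (l : List ℕ) :
    weight s f y (wheels l).2 = (l.map fun k => weight s f y (Character.wheel k)).prod := by
  induction l with
  | nil => exact weight_empty s f y
  | cons k l ih =>
    rw [List.map_cons, List.prod_cons, ← ih]
    exact weight_disjointUnion s f y _ _

/-- The linear map on `𝓐(∅)` given by the direct sum of `m` copies of `so(3)`. -/
noncomputable def soMap (m : ℕ) : AEmpty →ₗ[ℚ] MvPolynomial (Fin m) ℚ :=
  weightMap (soTensor_isLieTensor m) 0 0

theorem soMap_closure_wheelMap (z : ℚ) (m : ℕ) (F : MvPolynomial ℕ ℚ) :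
    soMap m (closure z (wheelMap F)) = gaussian (MvPolynomial.aeval
      (fun k => 2 * (-1) ^ (k + 1) * ∑ j, normSq m j ^ (k + 1)) F) := by
  induction F using MvPolynomial.induction_on' with
  | monomial μ r =>
    rw [wheelMap_monomial, map_smul, map_smul, closure_clsB, soMap,
      weightMap_closeChar _ _ _ (noInterval_wheels _), weight_wheels, MvPolynomial.aeval_monomial,
      ← Algebra.smul_def, LinearMap.map_smul_of_tower]
    congr 2
    rw [legNumbers, List.map_map, ← Multiset.prod_coe, ← Multiset.map_coe, Multiset.coe_toList,
      Finsupp.toMultiset_map, Finsupp.prod_toMultiset,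
      Finsupp.prod_mapDomain_index (fun _ => pow_zero _) (fun _ _ _ => pow_add _ _ _)]
    refine Finsupp.prod_congr fun k _ => ?_
    rw [Function.comp_apply, weight_wheel_soTensor]
  | add p q hp hq => simp only [map_add, hp, hq]

/-- Combinations of unions of wheels are determined by the weights of their closures. -/
theorem eq_of_soMap_closure_eq (z : ℚ) {x x' : B} (hx : x ∈ BWheels) (hx' : x' ∈ BWheels)
    (h : ∀ m, soMap m (closure z x) = soMap m (closure z x')) : x = x' := by
  obtain ⟨F, rfl⟩ := BWheels_le_range hx
  obtain ⟨G, rfl⟩ := BWheels_le_range hx'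
  refine congrArg _ (sub_eq_zero.mp (eq_zero_of_gaussian_aeval_wheels fun m => ?_))
  rw [map_sub, map_sub, ← soMap_closure_wheelMap z, ← soMap_closure_wheelMap z, h, sub_self]

theorem Character.IsWheels.t_eq {D : Character u} (h : D.IsWheels) : D.t = u := by
  induction h with
  | empty => rfl
  | union k u D _ _ ih => exact congrArg (k + ·) ih
  | iso u D E _ hDE ih =>
    obtain ⟨f, _⟩ := hDE
    have := Fintype.card_congr f
    rw [Fintype.card_fin, Fintype.card_fin] at this
    exact this.symm.trans ih

theorem closure_mem_AEmptyDeg (z : ℚ) (n : ℕ) {x : B} (hx : x ∈ BWheelsDeg (2 * n)) :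
    closure z x ∈ AEmptyDeg n := by
  have : BWheelsDeg (2 * n) ≤ (AEmptyDeg n).comap (closure z) := by
    refine Submodule.span_le.mpr ?_
    rintro x ⟨u, D, hD, hu, rfl⟩
    have ht := hD.t_eq
    rw [SetLike.mem_coe, Submodule.mem_comap, closure_clsB, closeChar]
    refine Submodule.sum_mem _ fun τ _ => Submodule.smul_mem _ _ (Submodule.subset_span ?_)
    refine ⟨D.join τ.1 τ.2, ?_, rfl⟩
    change D.t = 2 * n
    omega
  exact this hx

theorem BWheelsDeg_le (n : ℕ) : BWheelsDeg n ≤ BWheels := by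
  refine Submodule.span_mono ?_
  rintro x ⟨u, D, hD, _, rfl⟩
  exact ⟨u, D, hD, rfl⟩

end Wheels

/-! ### The cube and the Möbius ladder -/

section Ladder

/-- Edges of a trivalent graph on a cyclically ordered set of eight vertices: the flags `(v, 0)`
form the four edges joining `v` to `v + 4`, and `(v, 1)` is joined to `(ρ v, 2)`. -/
def ladderFun (ρ : Equiv.Perm (Fin 8)) : Flag 8 0 → Flag 8 0
  | Sum.inl (v, 0) => Sum.inl (v + 4, 0)
  | Sum.inl (v, 1) => Sum.inl (ρ v, 2)
  | Sum.inl (v, 2) => Sum.inl (ρ.symm v, 1)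
  | Sum.inr i => Sum.inr i

theorem ladderFun_invol (ρ : Equiv.Perm (Fin 8)) : Function.Involutive (ladderFun ρ) := by
  have h : ∀ v : Fin 8, v + 4 + 4 = v := by decide
  rintro (⟨v, j⟩ | i)
  · fin_cases j
    · exact congrArg (fun a => Sum.inl (a, (0 : Fin 3))) (h v)
    · exact congrArg (fun a => Sum.inl (a, (1 : Fin 3))) (ρ.symm_apply_apply v)
    · exact congrArg (fun a => Sum.inl (a, (2 : Fin 3))) (ρ.apply_symm_apply v)
  · exact i.elim0

/-- The trivalent graph with eight vertices `v`, rungs between `v` and `v + 4`, and further edges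
from `v` to `ρ v`. -/
def ladderGraph (ρ : Equiv.Perm (Fin 8)) : Character 0 where
  t := 8
  pair := (ladderFun_invol ρ).toPerm
  isMatching := by
    have h : ∀ v : Fin 8, v + 4 ≠ v := by decide
    refine ⟨ladderFun_invol ρ, ?_⟩
    rintro (⟨v, j⟩ | i)
    · fin_cases j
      · intro he
        exact h v (congrArg Prod.fst (Sum.inl_injective he))
      · intro he
        exact absurd (congrArg Prod.snd (Sum.inl_injective he)) (show (2 : Fin 3) ≠ 1 by decide)
      · intro he
        exact absurd (congrArg Prod.snd (Sum.inl_injective he)) (show (1 : Fin 3) ≠ 2 by decide)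
    · exact i.elim0

/-- The Möbius ladder with four rungs if `twisted`, and otherwise the cube. -/
def ladder (twisted : Bool) : Character 0 :=
  ladderGraph (finRotate 8 * if twisted then 1 else Equiv.swap 3 7)

variable {I R : Type} [Fintype I] [DecidableEq I] [CommRing R]

/-- The matrix of the operator on pairs of colours given by one rung of a ladder. -/
def rung (s : I → I) (f : I → I → I → R) (p q : I × I) : R :=
  ∑ r, f r p.1 (s q.1) * f (s r) p.2 (s q.2)

/-- The action of a rung on vectors. -/
def rungOp (s : I → I) (f : I → I → I → R) (g : I × I → R) (p : I × I) : R :=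
  ∑ q, rung s f p q * g q

/-- The identification of the two ends of a ladder. -/
def closing (twisted : Bool) (p : I × I) : I × I :=
  if twisted then p.swap else p

theorem weight_ladderGraph {s : I → I} (hs : ∀ a, s (s a) = a) (f : I → I → I → R) (y : I → R)
    (ρ : Equiv.Perm (Fin 8)) :
    weight s f y (ladderGraph ρ) = ∑ z : Fin 8 → I,
      rung s f (z 0, z 4) (z (ρ.symm 0), z (ρ.symm 4)) *
      rung s f (z 1, z 5) (z (ρ.symm 1), z (ρ.symm 5)) *
      rung s f (z 2, z 6) (z (ρ.symm 2), z (ρ.symm 6)) *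
      rung s f (z 3, z 7) (z (ρ.symm 3), z (ρ.symm 7)) := by
  -- the colours of the flags at the rungs
  let rc : (Fin 4 → I) → Fin 8 → I := fun r =>
    ![r 0, r 1, r 2, r 3, s (r 0), s (r 1), s (r 2), s (r 3)]
  have hrc : ∀ r v, rc r (v + 4) = s (rc r v) := by
    intro r v
    fin_cases v <;> first | rfl | exact (hs _).symm
  let col : (Fin 8 → I) × (Fin 4 → I) → Flag 8 0 → I := fun p x =>
    match x with
    | Sum.inl (v, 0) => rc p.2 v
    | Sum.inl (v, 1) => p.1 v
    | Sum.inl (v, 2) => s (p.1 (ρ.symm v))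
    | Sum.inr i => i.elim0
  have hcol : ∀ p, ∀ x, col p ((ladderGraph ρ).pair x) = s (col p x) := by
    rintro p (⟨v, j⟩ | i)
    · fin_cases j
      · exact hrc p.2 v
      · exact congrArg (fun a => s (p.1 a)) (ρ.symm_apply_apply v)
      · exact (hs _).symm
    · exact i.elim0
  have hinv : ∀ c : Coloring s (ladderGraph ρ), ∀ v : Fin 8,
      c.1 (Sum.inl ((v + 4 : Fin 8), 0)) = s (c.1 (Sum.inl (v, 0))) :=
    fun c v => c.2 (Sum.inl (v, 0))
  let e : (Fin 8 → I) × (Fin 4 → I) ≃ Coloring s (ladderGraph ρ) :=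
    { toFun := fun p => ⟨col p, hcol p⟩
      invFun := fun c => (fun v => c.1 (Sum.inl (v, 1)),
        ![c.1 (Sum.inl ((0 : Fin 8), 0)), c.1 (Sum.inl ((1 : Fin 8), 0)),
          c.1 (Sum.inl ((2 : Fin 8), 0)), c.1 (Sum.inl ((3 : Fin 8), 0))])
      left_inv := fun p => by
        refine Prod.ext rfl (funext fun i => ?_)
        fin_cases i <;> rfl
      right_inv := fun c => by
        refine Subtype.ext (funext ?_)
        rintro (⟨v, j⟩ | i)
        · fin_cases j
          · have hv : ∀ v : Fin 8, v = 0 ∨ v = 1 ∨ v = 2 ∨ v = 3 ∨ v = 0 + 4 ∨ v = 1 + 4 ∨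
                v = 2 + 4 ∨ v = 3 + 4 := by decide
            rcases hv v with rfl | rfl | rfl | rfl | rfl | rfl | rfl | rfl <;>
              first | rfl | exact (hinv c _).symm
          · rfl
          · exact (c.2 (Sum.inl (ρ.symm v, 1))).symm.trans
              (congrArg (fun a : Fin 8 => c.1 (Sum.inl (a, 2))) (ρ.apply_symm_apply v))
        · exact i.elim0 }
  rw [weight, ← Fintype.sum_equiv e _ _ fun p => rfl, Fintype.sum_prod_type]
  refine Finset.sum_congr rfl fun z _ => ?_
  let F : Fin 4 → I → R := fun i r =>
    f r (z (![0, 1, 2, 3] i)) (s (z (ρ.symm (![0, 1, 2, 3] i)))) *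
      f (s r) (z (![4, 5, 6, 7] i)) (s (z (ρ.symm (![4, 5, 6, 7] i))))
  have hF : rung s f (z 0, z 4) (z (ρ.symm 0), z (ρ.symm 4)) *
      rung s f (z 1, z 5) (z (ρ.symm 1), z (ρ.symm 5)) *
      rung s f (z 2, z 6) (z (ρ.symm 2), z (ρ.symm 6)) *
      rung s f (z 3, z 7) (z (ρ.symm 3), z (ρ.symm 7)) = ∏ i, ∑ r, F i r := by
    rw [Fin.prod_univ_four]
    rfl
  rw [hF, Fintype.prod_sum]
  refine Finset.sum_congr rfl fun r _ => ?_
  have h0 : ∀ g : Fin 0 → R, ∏ i, g i = 1 := fun g => Fintype.prod_empty g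
  rw [h0, mul_one, Fin.prod_univ_four]
  refine (Fin.prod_univ_eight _).trans ?_
  simp only [F, vertexValue, e, Equiv.coe_fn_mk, col, rc]
  simp only [Matrix.cons_val]
  ring

theorem rungOp_single (s : I → I) (f : I → I → I → R) (q : I × I) :
    rungOp s f (Pi.single q 1) = fun p => rung s f p q := by
  funext p
  simp [rungOp, Pi.single_apply]

/-- Ladders evaluate to traces of the fourth power of the rung operator, preceded by a swap for the
Möbius ladder. -/
theorem weight_ladder {s : I → I} (hs : ∀ a, s (s a) = a) (f : I → I → I → R) (y : I → R)
    (twisted : Bool) :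
    weight s f y (ladder twisted) = ∑ p : I × I,
      rungOp s f (rungOp s f (rungOp s f (rungOp s f (Pi.single (closing twisted p) 1)))) p := by
  have h : weight s f y (ladder twisted) = ∑ z : Fin 8 → I,
      rung s f (z 3, z 7) (z 2, z 6) * (rung s f (z 2, z 6) (z 1, z 5) *
        (rung s f (z 1, z 5) (z 0, z 4) *
          rung s f (z 0, z 4) (closing twisted (z 3, z 7)))) := by
    rw [ladder, weight_ladderGraph hs]
    refine Finset.sum_congr rfl fun z _ => ?_
    rcases twisted with _ | _
    · have e : ∀ v : Fin 8, (finRotate 8 * if false then 1 else Equiv.swap 3 7).symm v =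
          ![3, 0, 1, 2, 7, 4, 5, 6] v := by decide
      generalize (finRotate 8 * if false then 1 else Equiv.swap 3 7) = ρ at e ⊢
      simp only [e]
      simp only [closing, Matrix.cons_val, Bool.false_eq_true, if_false]
      ring
    · have e : ∀ v : Fin 8, (finRotate 8 * if true then 1 else Equiv.swap 3 7).symm v =
          ![7, 0, 1, 2, 3, 4, 5, 6] v := by decide
      generalize (finRotate 8 * if true then 1 else Equiv.swap 3 7) = ρ at e ⊢
      simp only [e]
      simp only [closing, Matrix.cons_val, if_true, Prod.swap_prod_mk]
      ring
  let e : ((I × I) × (I × I) × (I × I) × (I × I)) ≃ (Fin 8 → I) :=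
    { toFun := fun p =>
        ![p.2.2.2.1, p.2.2.1.1, p.2.1.1, p.1.1, p.2.2.2.2, p.2.2.1.2, p.2.1.2, p.1.2]
      invFun := fun z => ((z 3, z 7), (z 2, z 6), (z 1, z 5), (z 0, z 4))
      left_inv := fun p => rfl
      right_inv := fun z => by
        funext i
        fin_cases i <;> rfl }
  rw [h, ← Fintype.sum_equiv e _ _ fun p => rfl]
  simp only [rungOp_single, Fintype.sum_prod_type]
  simp only [rungOp, Fintype.sum_prod_type, Finset.mul_sum]
  rfl

end Ladder

/-! ### The `so(3)`-weights of the ladders -/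

section Evaluate

theorem rungOp_eps (g : Fin 3 × Fin 3 → ℤ) :
    rungOp id eps g = fun p => (if p.1 = p.2 then ∑ c, g (c, c) else 0) - g (p.2, p.1) := by
  have h : ∀ p q : Fin 3 × Fin 3, rung id eps p q =
      (if p.1 = p.2 then if q.1 = q.2 then 1 else 0 else 0) -
        if q = (p.2, p.1) then 1 else 0 := by decide
  funext p
  simp only [rungOp, h, sub_mul, Finset.sum_sub_distrib, ite_mul, one_mul, zero_mul,
    Finset.sum_ite_eq', Finset.mem_univ, if_true]
  congr 1
  split_ifs with hp
  · simp [Fintype.sum_prod_type]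
  · simp

theorem weight_ladder_eps (twisted : Bool) (y : Fin 3 → ℤ) :
    weight id eps y (ladder twisted) = if twisted then 18 else 24 := by
  -- the square of the rung operator is the identity plus an operator of rank one
  have h2 : ∀ g, rungOp id eps (rungOp id eps g) =
      fun p => (if p.1 = p.2 then ∑ c, g (c, c) else 0) + g p := by
    intro g
    funext p
    simp only [rungOp_eps, Fin.sum_univ_three, if_true, eq_comm (a := p.2)]
    split_ifs <;> ring
  rw [weight_ladder fun _ => rfl]
  simp only [h2]
  rcases twisted with _ | _ <;> decide +kernel

/-- The colour has to be the same along a connected graph, and each vertex contributes a factor. -/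
theorem weight_ladder_copyTensor (m : ℕ) (twisted : Bool) (y : Fin m → MvPolynomial (Fin m) ℚ) :
    weight id (copyTensor m) y (ladder twisted) = ∑ j, MvPolynomial.X j ^ 8 := by
  have h : ∀ p q : Fin m × Fin m, rung id (copyTensor m) p q =
      if p.1 = p.2 then if q = p then MvPolynomial.X p.1 ^ 2 else 0 else 0 := by
    rintro ⟨a, b⟩ ⟨c, d⟩
    have h1 : ∀ r, copyTensor m r a c * copyTensor m r b d =
        if r = a then (if a = b then if (c, d) = (a, b) then MvPolynomial.X a ^ 2 else 0 else 0)
          else 0 := by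
      intro r
      rw [copyTensor_mul]
      simp only [Prod.mk.injEq]
      split_ifs <;> grind
    simp only [rung, id_eq, h1, Finset.sum_ite_eq', Finset.mem_univ, if_true]
  have hop : ∀ g, rungOp id (copyTensor m) g =
      fun p => if p.1 = p.2 then MvPolynomial.X p.1 ^ 2 * g p else 0 := by
    intro g
    funext p
    simp only [rungOp, h]
    split_ifs with hp
    · simp
    · simp
  rw [weight_ladder (fun _ => rfl), Fintype.sum_prod_type]
  simp only [hop]
  refine Finset.sum_congr rfl fun j _ => ?_
  rw [Finset.sum_eq_single j]
  · have hc : closing twisted (j, j) = (j, j) := by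
      rcases twisted with _ | _ <;> rfl
    simp only [if_true, hc, Pi.single_eq_same]
    ring
  · intro k _ hk
    rw [if_neg (fun h => hk h.symm)]
  · simp

/-- The tensor of the direct sum is a product, so the weights multiply. -/
theorem soMap_cls_ladder (m : ℕ) (twisted : Bool) :
    soMap m (cls (ladder twisted)) =
      (if twisted then 18 else 24) * ∑ j, MvPolynomial.X j ^ 8 := by
  rw [soMap, weightMap_cls]
  have h := weight_prod (fun a b c => (eps a b c : MvPolynomial (Fin m) ℚ)) (copyTensor m)
    (ladder twisted) 0 0 0
  have h2 := map_weight (Int.castRingHom (MvPolynomial (Fin m) ℚ)) id eps 0 (ladder twisted)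
  have h3 : weight id (fun a b c => (eps a b c : MvPolynomial (Fin m) ℚ)) 0 (ladder twisted) =
      if twisted then 18 else 24 := by
    have h4 : (fun a => (Int.castRingHom (MvPolynomial (Fin m) ℚ)) ((0 : Fin 3 → ℤ) a)) = 0 := by
      funext a
      simp
    rw [h4] at h2
    refine h2.trans ?_
    rw [weight_ladder_eps]
    rcases twisted with _ | _ <;> simp
  rw [h3, weight_ladder_copyTensor] at h
  exact h

/-! ### The `gl(3)`-weights of the ladders -/

/-- The structure constants `tr (E_a [E_b, E_c])` of `gl(3)` in the basis of matrix units. -/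
def glTensor (a b c : Fin 3 × Fin 3) : ℤ :=
  (if a.2 = b.1 ∧ b.2 = c.1 ∧ c.2 = a.1 then 1 else 0) -
    if a.2 = c.1 ∧ c.2 = b.1 ∧ b.2 = a.1 then 1 else 0

open Matrix in
theorem glTensor_eq (a b c : Fin 3 × Fin 3) :
    glTensor a b c = (single b.1 b.2 (1 : ℤ) * single c.1 c.2 1 -
      single c.1 c.2 1 * single b.1 b.2 1 : Matrix (Fin 3) (Fin 3) ℤ) a.2 a.1 := by
  have h : ∀ b c : Fin 3 × Fin 3, ∀ i j, (single b.1 b.2 (1 : ℤ) * single c.1 c.2 1 :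
      Matrix (Fin 3) (Fin 3) ℤ) i j = if i = b.1 ∧ b.2 = c.1 ∧ c.2 = j then 1 else 0 := by
    intro b c i j
    rw [Matrix.mul_apply, Finset.sum_eq_single b.2]
    · simp only [single_apply]
      split_ifs <;> grind
    · intro k _ hk
      simp [single_apply, hk.symm]
    · simp
  rw [Matrix.sub_apply, h, h]
  rfl

open Matrix in
theorem glTensor_isLieTensor : IsLieTensor Prod.swap glTensor where
  invol a := a.swap_swap
  cyclic a b c := by
    unfold glTensor
    congr 1 <;> congr 1 <;> apply propext <;> tauto
  antisymm a b c := by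
    unfold glTensor
    ring
  jacobi a b c d := by
    have hsum : ∀ X Y : Matrix (Fin 3) (Fin 3) ℤ,
        ∑ e : Fin 3 × Fin 3, X e.2 e.1 * Y e.swap.2 e.swap.1 = (X * Y).trace := by
      intro X Y
      rw [Fintype.sum_prod_type, Finset.sum_comm]
      rfl
    have hcomm : ∀ X C D : Matrix (Fin 3) (Fin 3) ℤ,
        (X * (C * D - D * C)).trace = ((X * C - C * X) * D).trace := by
      intro X C D
      rw [mul_sub, sub_mul, trace_sub, trace_sub, ← mul_assoc, ← mul_assoc,
        trace_mul_comm (X * D) C, ← mul_assoc]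
    simp only [glTensor_eq, Finset.sum_add_distrib, hsum, hcomm]
    rw [← trace_add, ← trace_add, ← add_mul, ← add_mul]
    have : ∀ A B C : Matrix (Fin 3) (Fin 3) ℤ, (A * B - B * A) * C - C * (A * B - B * A) +
        ((B * C - C * B) * A - A * (B * C - C * B)) +
        ((C * A - A * C) * B - B * (C * A - A * C)) = 0 := by
      intro A B C
      noncomm_ring
    rw [this, zero_mul, trace_zero]

/-- The rung operator of `gl(3)` on pairs of matrix units. Expanding the two commutators gives four
terms. -/
theorem rung_glTensor (p q : (Fin 3 × Fin 3) × (Fin 3 × Fin 3)) :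
    rung Prod.swap glTensor p q =
      (if q = ((p.2.1, p.1.2), (p.1.1, p.2.2)) then 1 else 0) +
      (if q = ((p.1.1, p.2.2), (p.2.1, p.1.2)) then 1 else 0) -
      (if p.2.2 = p.1.1 then ∑ m, if q = ((m, p.1.2), (p.2.1, m)) then 1 else 0 else 0) -
      (if p.1.2 = p.2.1 then ∑ m, if q = ((p.1.1, m), (m, p.2.2)) then 1 else 0 else 0) := by
  obtain ⟨⟨a, b⟩, ⟨c, d⟩⟩ := p
  obtain ⟨⟨x, y⟩, ⟨z, w⟩⟩ := q
  rw [rung, Fintype.sum_prod_type]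
  simp only [glTensor, Prod.swap_prod_mk, mul_sub, Finset.sum_sub_distrib, ite_and, mul_ite,
    mul_zero, mul_one, Finset.sum_ite_eq, Finset.sum_ite_eq', Finset.mem_univ, if_true,
    Prod.mk.injEq, Finset.sum_ite_irrel, Finset.sum_const_zero]
  grind

theorem rungOp_glTensor (g : (Fin 3 × Fin 3) × (Fin 3 × Fin 3) → ℤ) :
    rungOp Prod.swap glTensor g = fun p =>
      g ((p.2.1, p.1.2), (p.1.1, p.2.2)) + g ((p.1.1, p.2.2), (p.2.1, p.1.2)) -
      (if p.2.2 = p.1.1 then ∑ m, g ((m, p.1.2), (p.2.1, m)) else 0) -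
      (if p.1.2 = p.2.1 then ∑ m, g ((p.1.1, m), (m, p.2.2)) else 0) := by
  funext p
  simp only [rungOp, rung_glTensor, sub_mul, add_mul, ite_mul, one_mul, zero_mul,
    Finset.sum_sub_distrib, Finset.sum_add_distrib, Finset.sum_ite_eq', Finset.mem_univ, if_true,
    Finset.sum_mul]
  congr 1
  · congr 1
    split_ifs
    · rw [Finset.sum_comm]
      simp
    · simp
  · split_ifs
    · rw [Finset.sum_comm]
      simp
    · simp

/-- The rung operator of `gl(3)` in curried form, which the kernel evaluates quickly. -/
def glRungOp (g : Fin 3 → Fin 3 → Fin 3 → Fin 3 → ℤ) (a b c d : Fin 3) : ℤ :=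
  g c b a d + g a d c b -
  (if d = a then g 0 b c 0 + g 1 b c 1 + g 2 b c 2 else 0) -
  (if b = c then g a 0 0 d + g a 1 1 d + g a 2 2 d else 0)

theorem rungOp_glTensor_curry (g : Fin 3 → Fin 3 → Fin 3 → Fin 3 → ℤ) :
    rungOp Prod.swap glTensor (fun p => g p.1.1 p.1.2 p.2.1 p.2.2) =
      fun p => glRungOp g p.1.1 p.1.2 p.2.1 p.2.2 := by
  rw [rungOp_glTensor]
  simp only [Fin.sum_univ_three, glRungOp]

/-- The curried basis vectors on which `glRungOp` acts. -/
def glSingle (x y z w a b c d : Fin 3) : ℤ :=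
  if a = x then if b = y then if c = z then if d = w then 1 else 0 else 0 else 0 else 0

theorem single_eq_glSingle (q : (Fin 3 × Fin 3) × (Fin 3 × Fin 3)) :
    (Pi.single q 1 : (Fin 3 × Fin 3) × (Fin 3 × Fin 3) → ℤ) =
      fun p => glSingle q.1.1 q.1.2 q.2.1 q.2.2 p.1.1 p.1.2 p.2.1 p.2.2 := by
  funext p
  simp only [Pi.single_apply, glSingle, Prod.ext_iff, ite_and]

theorem weight_ladder_glTensor (twisted : Bool) (y : Fin 3 × Fin 3 → ℤ) :
    weight Prod.swap glTensor y (ladder twisted) = if twisted then 1728 else 3024 := by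
  rw [weight_ladder Prod.swap_swap]
  simp only [single_eq_glSingle, rungOp_glTensor_curry, Fintype.sum_prod_type]
  rcases twisted with _ | _ <;> decide +kernel

/-! ### An element invisible for `so(3)` in each degree -/

/-- The theta graph: two vertices joined by three edges. -/
def theta : Character 0 where
  t := 2
  pair := Equiv.sumCongr (Equiv.prodCongr (Equiv.swap 0 1) 1) 1
  isMatching := by
    refine ⟨?_, ?_⟩
    · rintro (⟨v, j⟩ | i)
      · simp
      · exact i.elim0
    · rintro (⟨v, j⟩ | i)
      · fin_cases v <;> simp
      · exact i.elim0

/-- The weight is minus the sum of the squares of all structure constants. -/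
theorem weight_theta_glTensor (y : Fin 3 × Fin 3 → ℤ) :
    weight Prod.swap glTensor y theta ≠ 0 := by
  let col : (Fin 3 → Fin 3 × Fin 3) → Flag 2 0 → Fin 3 × Fin 3 := fun x a =>
    match a with
    | Sum.inl (v, j) => if v = 0 then x j else (x j).swap
    | Sum.inr i => i.elim0
  have hcol : ∀ x a, col x (theta.pair a) = (col x a).swap := by
    rintro x (⟨v, j⟩ | i)
    · have hv : ∀ v : Fin 2, v = 0 ∨ v = 1 := by decide
      rcases hv v with rfl | rfl
      · rfl
      · exact (Prod.swap_swap _).symm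
    · exact i.elim0
  let e : (Fin 3 → Fin 3 × Fin 3) ≃ Coloring Prod.swap theta :=
    { toFun := fun x => ⟨col x, hcol x⟩
      invFun := fun c j => c.1 (Sum.inl ((0 : Fin 2), j))
      left_inv := fun x => rfl
      right_inv := fun c => by
        refine Subtype.ext (funext ?_)
        rintro (⟨v, j⟩ | i)
        · have hv : ∀ v : Fin 2, v = 0 ∨ v = 1 := by decide
          rcases hv v with rfl | rfl
          · rfl
          · exact (c.2 (Sum.inl ((0 : Fin 2), j))).symm
        · exact i.elim0 }
  have h : weight Prod.swap glTensor y theta = ∑ x : Fin 3 → Fin 3 × Fin 3,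
      glTensor (x 0) (x 1) (x 2) * glTensor (x 0).swap (x 1).swap (x 2).swap := by
    rw [weight, ← Fintype.sum_equiv e _ _ fun p => rfl]
    refine Finset.sum_congr rfl fun x _ => ?_
    have h0 : ∀ g : Fin 0 → ℤ, ∏ i, g i = 1 := fun g => Fintype.prod_empty g
    rw [h0, mul_one]
    exact Fin.prod_univ_two _
  -- transposition is an anti-automorphism, so it changes the sign of the structure constants
  have hswap : ∀ a b c, glTensor a.swap b.swap c.swap = -glTensor a b c := by
    intro a b c
    unfold glTensor
    grind
  rw [h]
  simp only [hswap, mul_neg, Finset.sum_neg_distrib, ne_eq, neg_eq_zero]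
  rw [Finset.sum_eq_zero_iff_of_nonneg fun x _ => mul_self_nonneg _]
  intro h0
  exact absurd (h0 ![(0, 0), (0, 1), (1, 0)] (Finset.mem_univ _)) (by decide)

/-- Disjoint union with `r` theta graphs. -/
def addThetas (D : Character 0) : ℕ → Character 0
  | 0 => D
  | r + 1 => theta.disjointUnion (addThetas D r)

theorem addThetas_t (D : Character 0) (r : ℕ) : (addThetas D r).t = 2 * r + D.t := by
  induction r with
  | zero => simp [addThetas]
  | succ r ih =>
    change 2 + (addThetas D r).t = _
    rw [ih]
    ring

theorem weight_addThetas {I R : Type} [Fintype I] [DecidableEq I] [CommRing R] (s : I → I)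
    (f : I → I → I → R) (y : I → R) (D : Character 0) (r : ℕ) :
    weight s f y (addThetas D r) = weight s f y theta ^ r * weight s f y D := by
  induction r with
  | zero => simp [addThetas]
  | succ r ih =>
    refine (weight_disjointUnion s f y theta (addThetas D r)).trans ?_
    rw [ih]
    ring

/-- An element of `𝓐(∅)` of degree `r + 4` that is killed by the weights for the direct sums of
copies of `so(3)`, since `3 · 24 = 4 · 18`. -/
noncomputable def invisible (r : ℕ) : AEmpty :=
  (3 : ℚ) • cls (addThetas (ladder false) r) - (4 : ℚ) • cls (addThetas (ladder true) r)

theorem invisible_mem (r : ℕ) : invisible r ∈ AEmptyDeg (r + 4) := by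
  refine Submodule.sub_mem _ (Submodule.smul_mem _ _ (Submodule.subset_span ?_))
    (Submodule.smul_mem _ _ (Submodule.subset_span ?_))
  all_goals
    refine ⟨_, ?_, rfl⟩
    rw [addThetas_t]
    change 2 * r + 8 = 2 * (r + 4)
    ring

theorem soMap_invisible (m r : ℕ) : soMap m (invisible r) = 0 := by
  have h1 := soMap_cls_ladder m false
  have h2 := soMap_cls_ladder m true
  simp only [soMap, weightMap_cls, Bool.false_eq_true, if_false, if_true] at h1 h2
  rw [invisible, map_sub, map_smul, map_smul, soMap, weightMap_cls, weightMap_cls,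
    weight_addThetas, weight_addThetas, h1, h2, MvPolynomial.smul_eq_C_mul,
    MvPolynomial.smul_eq_C_mul, map_ofNat, map_ofNat]
  ring

theorem invisible_ne_zero (r : ℕ) : invisible r ≠ 0 := by
  have hgl : IsLieTensor Prod.swap (fun a b c => (glTensor a b c : ℚ)) :=
    { invol := glTensor_isLieTensor.invol
      cyclic := fun a b c => by rw [glTensor_isLieTensor.cyclic]
      antisymm := fun a b c => by rw [glTensor_isLieTensor.antisymm, Int.cast_neg]
      jacobi := fun a b c d => by exact_mod_cast glTensor_isLieTensor.jacobi a b c d }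
  have hw : ∀ D : Character 0, weightMap hgl (fun _ => ((0 : ℤ) : ℚ)) 0 (cls D) =
      ((weight Prod.swap glTensor (fun _ => 0) D : ℤ) : ℚ) := fun D =>
    (weightMap_cls hgl _ D).trans
      (map_weight (Int.castRingHom ℚ) Prod.swap glTensor (fun _ => 0) D)
  intro h
  have h1 := congrArg (weightMap hgl (fun _ => ((0 : ℤ) : ℚ)) 0) h
  rw [invisible, map_sub, map_smul, map_smul, hw, hw, weight_addThetas, weight_addThetas,
    weight_ladder_glTensor, weight_ladder_glTensor, map_zero] at h1
  have h2 : ((weight Prod.swap glTensor (fun _ => 0) theta : ℤ) : ℚ) ^ r ≠ 0 :=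
    pow_ne_zero _ (Int.cast_ne_zero.mpr (weight_theta_glTensor _))
  simp only [Bool.false_eq_true, if_false, if_true, smul_eq_mul] at h1
  push_cast at h1
  apply h2
  linarith

end Evaluate

end JacobiDiagram

theorem mainTheorem4 (z : ℚ) :
    Function.Injective ((JacobiDiagram.closure z).domRestrict JacobiDiagram.BWheels) ∧
    (∀ n : ℕ, Set.MapsTo (JacobiDiagram.closure z)
      (JacobiDiagram.BWheelsDeg (2 * n)) (JacobiDiagram.AEmptyDeg n)) ∧
    ∀ n : ℕ, 4 ≤ n → ¬ Set.SurjOn (JacobiDiagram.closure z)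
      (JacobiDiagram.BWheelsDeg (2 * n)) (JacobiDiagram.AEmptyDeg n) := by
  refine ⟨?_, fun n x hx => JacobiDiagram.closure_mem_AEmptyDeg z n hx, fun n hn h => ?_⟩
  · rintro ⟨x, hx⟩ ⟨x', hx'⟩ h
    exact Subtype.ext (JacobiDiagram.eq_of_soMap_closure_eq z hx hx' fun m =>
      congrArg (JacobiDiagram.soMap m) h)
  · obtain ⟨r, rfl⟩ := Nat.exists_eq_add_of_le' hn
    obtain ⟨x, hx, hxy⟩ := h (JacobiDiagram.invisible_mem r)
    have hx0 : x = 0 := JacobiDiagram.eq_of_soMap_closure_eq z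
      (JacobiDiagram.BWheelsDeg_le _ hx) (zero_mem _) fun m => by
        rw [hxy, JacobiDiagram.soMap_invisible, map_zero, map_zero]
    rw [hx0, map_zero] at hxy
    exact JacobiDiagram.invisible_ne_zero r hxy.symm
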